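/- Let $n\ge 1$ and let $\Omega=\mathrm{conv}(v_1,\dots,v_m)\subset\mathbf R^n$ be an $n$-dimensional compact convex polytope such that $v_i\notin \mathrm{conv}(v_1,\dots,v_{i-1},v_{i+1},\dots,v_m)$ for all $i$, and let $p_1,\dots,p_k$ be distinct points in the interior of $\Omega$. A convex cell decomposition of $\Omega$ is a finite collection $\mathcal T$ of convex polyhedra (cells) with union $\Omega$ such that the intersection of two cells is a cell and a subset $\tau$ of a cell $\sigma$ is a cell if and only if it is a face of $\sigma$ (the empty set and $\sigma$ itself count as faces); its vertices are its zero-dimensional cells. A piecewise linear (PL) convex function $w:(\Omega,\mathcal T)\to\mathbf R$ is a convex function on $\Omega$ that is affine on each cell, and its discrete Hessian determinant at a vertex is the volume of the convex hull of the gradients of $w$ on the $n$-dimensional cells containing this vertex. Then for any $g_1,\dots,g_m\in\mathbf R$ and any $A_1,\dots,A_k>0$ there exist a convex cell decomposition $\mathcal T$ of $\Omega$ whose set of vertices is exactly $\{v_1,\dots,v_m,p_1,\dots,p_k\}$ and a PL convex function $w:(\Omega,\mathcal T)\to\mathbf R$ such that $w(v_i)=g_i$ for $i=1,\dots,m$ and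 the discrete Hessian determinant of $w$ at $p_j$ equals $A_j$ for $j=1,\dots,k$. Moreover, $w$ can be chosen as follows. For $h\in\mathbf R^k$ put $$u_h(x)=\max\{x\cdot p_j+h_j,\ x\cdot v_i-g_i \mid j=1,\dots,k,\ i=1,\dots,m\},$$ let $W_j(h)$ be the closed set of all $x$ with $u_h(x)=x\cdot p_j+h_j$ and $W_{k+i}(h)$ the closed set of all $x$ with $u_h(x)=x\cdot v_i-g_i$, and let $H$ be the set of all $h\in\mathbf R^k$ such that $\mathrm{vol}(W_s(h))>0$ for $s=1,\dots,k+m$. Then $H$ is open and convex, and there is a strictly convex differentiable function $F:H\to\mathbf R$ with $\partial F/\partial h_j=\mathrm{vol}(W_j(h))-A_j$ for $j=1,\dots,k$, which has a unique critical point $h$ in $H$. For this $h$, $w$ is the Legendre dual of $u_h$: $\sup_{x\in\mathbf R^n}(x\cdot y-u_h(x))$ equals $w(y)$ for $y\in\Omega$ and $+\infty$ for $y\notin\Omega$. -/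

import Mathlib

open Set MeasureTheory
open scoped ENNReal

noncomputable section

namespace DMAE

/-- A convex polyhedron: an intersection of finitely many closed half spaces. -/
def IsConvexPolyhedron {n : ℕ} (s : Set (EuclideanSpace ℝ (Fin n))) : Prop :=
  ∃ (N : ℕ) (a : Fin N → EuclideanSpace ℝ (Fin n)) (b : Fin N → ℝ),
    s = {x | ∀ i, inner ℝ (a i) x ≤ b i}

/-- A (finite) convex subdivision, or convex cell decomposition, of `K`. The faces of a polyhedron
are its exposed faces; the empty set and the polyhedron itself count as faces, so that the
intersection of two disjoint cells is also a cell. -/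
structure IsConvexSubdivision {n : ℕ} (K : Set (EuclideanSpace ℝ (Fin n)))
    (T : Set (Set (EuclideanSpace ℝ (Fin n)))) : Prop where
  finite : T.Finite
  polyhedron : ∀ σ ∈ T, IsConvexPolyhedron σ
  cover : ⋃₀ T = K
  inter : ∀ σ ∈ T, ∀ τ ∈ T, σ ∩ τ ∈ T
  face : ∀ σ ∈ T, ∀ τ, τ ⊆ σ → (τ ∈ T ↔ IsExposed ℝ σ τ)

/-- The vertices of a subdivision: its zero-dimensional cells. -/
def vertices {n : ℕ} (T : Set (Set (EuclideanSpace ℝ (Fin n)))) :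
    Set (EuclideanSpace ℝ (Fin n)) :=
  {x | {x} ∈ T}

/-- `w` agrees on `σ` with an affine function of gradient `a`. If `σ` has an interior point, then
`a` is determined by `w` and `σ`. -/
def HasGradientOnCell {n : ℕ} (w : EuclideanSpace ℝ (Fin n) → ℝ)
    (σ : Set (EuclideanSpace ℝ (Fin n))) (a : EuclideanSpace ℝ (Fin n)) : Prop :=
  ∃ c : ℝ, ∀ y ∈ σ, w y = inner ℝ a y + c

/-- `w` is a PL convex function on `(K, T)`: convex on `K`, affine on each cell of `T`. The values
of `w` outside `K` are irrelevant. -/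
def IsPLConvexOn {n : ℕ} (K : Set (EuclideanSpace ℝ (Fin n)))
    (T : Set (Set (EuclideanSpace ℝ (Fin n)))) (w : EuclideanSpace ℝ (Fin n) → ℝ) : Prop :=
  ConvexOn ℝ K w ∧ ∀ σ ∈ T, ∃ a, HasGradientOnCell w σ a

/-- The discrete Hessian determinant of `w` at `x`: the volume of the convex hull of the gradients
of `w` at the top-dimensional cells of `T` that contain `x`. -/
def discreteHessianDet {n : ℕ} (T : Set (Set (EuclideanSpace ℝ (Fin n))))
    (w : EuclideanSpace ℝ (Fin n) → ℝ) (x : EuclideanSpace ℝ (Fin n)) : ℝ≥0∞ :=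
  volume (convexHull ℝ
    {a | ∃ σ ∈ T, (interior σ).Nonempty ∧ x ∈ σ ∧ HasGradientOnCell w σ a})

/-- The Legendre-Fenchel dual of a proper function with values in `(-∞, ∞]`. -/
def legendreDual {n : ℕ} (f : EuclideanSpace ℝ (Fin n) → EReal)
    (y : EuclideanSpace ℝ (Fin n)) : EReal :=
  ⨆ x : EuclideanSpace ℝ (Fin n), ((inner ℝ x y : ℝ) : EReal) - f x

/-- The function `x ↦ max_i (x · q_i + c_i)`, for a finite nonempty family. -/
def plMax {n : ℕ} {ι : Type*} (q : ι → EuclideanSpace ℝ (Fin n)) (c : ι → ℝ)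
    (x : EuclideanSpace ℝ (Fin n)) : ℝ :=
  ⨆ i, (inner ℝ x (q i) + c i)

/-- The polyhedron of all `x` at which the `i`-th term of `max_j (x · q_j + c_j)` is a largest
one. -/
def maxCell {n : ℕ} {ι : Type*} (q : ι → EuclideanSpace ℝ (Fin n)) (c : ι → ℝ) (i : ι) :
    Set (EuclideanSpace ℝ (Fin n)) :=
  {x | ∀ j, inner ℝ x (q j) + c j ≤ inner ℝ x (q i) + c i}

/-- The joint family of the slopes: the points `p_j`, then the points `v_i`. -/
def sites {n k m : ℕ} (p : Fin k → EuclideanSpace ℝ (Fin n))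
    (v : Fin m → EuclideanSpace ℝ (Fin n)) : Fin k ⊕ Fin m → EuclideanSpace ℝ (Fin n) :=
  Sum.elim p v

/-- The joint family of the constant terms: `h_j` at `p_j` and `-g_i` at `v_i`. -/
def heights {k m : ℕ} (g : Fin m → ℝ) (h : EuclideanSpace ℝ (Fin k)) : Fin k ⊕ Fin m → ℝ :=
  Sum.elim (fun j => h j) (fun i => -g i)

/-- The set `H` of all `h` for which every cell of
`max {x · p_j + h_j, x · v_i - g_i}` has positive volume. -/
def admissible {n k m : ℕ} (p : Fin k → EuclideanSpace ℝ (Fin n))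
    (v : Fin m → EuclideanSpace ℝ (Fin n)) (g : Fin m → ℝ) : Set (EuclideanSpace ℝ (Fin k)) :=
  {h | ∀ s, 0 < volume (maxCell (sites p v) (heights g h) s)}

end DMAE

end

/-! The solution is dual to a maximum of affine functions. For `u = plMax q c`, the subdifferential
at `x` is the hull of the slopes active there (`mem_dualCell_iff`). These hulls tile the hull of all
slopes and their faces are again such hulls (`isConvexSubdivision_dualSubdivision`); the Legendre
dual of `u` is affine with gradient `x` on the cell of `x`. The gradients on the top cells around an
interior site lie in its maximality domain and include all extreme points of that domain, so the
discrete Hessian determinant is the volume of the domain (`discreteHessianDet_dualSubdivision`). The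
problem thus becomes to find `h` with `vol W_j(h) = A_j`.

This is variational. Let `energy` be the integral of `u_h` minus the maximum of the vertex terms
alone, less `∑ A_j h_j`. The integrand has compact support because each `p_j` is interior, and its
derivative in `h_j` is almost everywhere the indicator of `W_j(h)`, so the gradient is `vol W_j -
A_j` (`hasGradientAt_energy`). A maximum of functions affine in `h` is convex; strictness on `H`
comes from a connectedness argument (`eq_of_excess_combo_eq`).

The energy is coercive on all of `ℝ^k` (`exists_energy_lower_bound`): for large positive `h_j` the
integral outgrows any linear function, and for negative `h_j` the term `-A_j h_j` grows. Hence a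
global minimum exists. There `vol W_j = A_j > 0`, while the vertex domains always have positive
volume, so the minimizer lies in `H` without any boundary analysis. -/

namespace DMAE

open Filter Topology

/-! ### Separation from convex sets. -/

section Separation

variable {E : Type*} [NormedAddCommGroup E] [InnerProductSpace ℝ E]

lemma inner_le_of_mem_convexHull {s : Set E} {a y : E} {b : ℝ}
    (h : ∀ z ∈ s, inner ℝ a z ≤ b) (hy : y ∈ convexHull ℝ s) : inner ℝ a y ≤ b := by
  have hc : Convex ℝ {z : E | inner ℝ a z ≤ b} :=
    convex_halfSpace_le (f := fun z => inner ℝ a z) (innerₛₗ ℝ a).isLinear b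
  exact convexHull_min h hc hy

lemma exists_inner_lt_of_notMem [CompleteSpace E] {s : Set E} {y : E} (hs : Convex ℝ s)
    (hc : IsClosed s) (hy : y ∉ s) :
    ∃ (a : E) (r : ℝ), (∀ z ∈ s, inner ℝ a z < r) ∧ r < inner ℝ a y := by
  obtain ⟨f, r, h1, h2⟩ := geometric_hahn_banach_closed_point hs hc hy
  refine ⟨(InnerProductSpace.toDual ℝ E).symm f, r, fun z hz => ?_, ?_⟩
  · simpa using h1 z hz
  · simpa using h2

end Separation

/-! ### Maxima of affine functions, their subdifferentials and Legendre duals. -/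

section PLMax

variable {n : ℕ} {ι : Type*} {q : ι → EuclideanSpace ℝ (Fin n)} {c : ι → ℝ}
  {x y : EuclideanSpace ℝ (Fin n)}

lemma le_plMax [Finite ι] (q : ι → EuclideanSpace ℝ (Fin n)) (c : ι → ℝ)
    (x : EuclideanSpace ℝ (Fin n)) (i : ι) : inner ℝ x (q i) + c i ≤ plMax q c x :=
  le_ciSup (f := fun i => inner ℝ x (q i) + c i) (Set.finite_range _).bddAbove i

lemma plMax_le [Nonempty ι] {b : ℝ} (h : ∀ i, inner ℝ x (q i) + c i ≤ b) : plMax q c x ≤ b :=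
  ciSup_le h

lemma mem_maxCell_iff [Finite ι] [Nonempty ι] {i : ι} :
    x ∈ maxCell q c i ↔ plMax q c x = inner ℝ x (q i) + c i :=
  ⟨fun h => le_antisymm (plMax_le h) (le_plMax q c x i), fun h j => h ▸ le_plMax q c x j⟩

lemma exists_mem_maxCell [Finite ι] [Nonempty ι] (q : ι → EuclideanSpace ℝ (Fin n)) (c : ι → ℝ)
    (x : EuclideanSpace ℝ (Fin n)) : ∃ i, x ∈ maxCell q c i :=
  Finite.exists_max fun i => inner ℝ x (q i) + c i

lemma isClosed_maxCell (q : ι → EuclideanSpace ℝ (Fin n)) (c : ι → ℝ) (i : ι) :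
    IsClosed (maxCell q c i) := by
  rw [maxCell, ofPred_forall]
  exact isClosed_iInter fun j => isClosed_le (by fun_prop) (by fun_prop)

lemma convex_maxCell (q : ι → EuclideanSpace ℝ (Fin n)) (c : ι → ℝ) (i : ι) :
    Convex ℝ (maxCell q c i) := by
  intro x hx y hy a b ha hb hab j
  have h1 := mul_le_mul_of_nonneg_left (hx j) ha
  have h2 := mul_le_mul_of_nonneg_left (hy j) hb
  simp only [inner_add_left, real_inner_smul_left]
  have e1 : c j = a * c j + b * c j := by rw [← add_mul, hab, one_mul]
  have e2 : c i = a * c i + b * c i := by rw [← add_mul, hab, one_mul]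
  linarith

lemma eventually_active_subset [Finite ι] (q : ι → EuclideanSpace ℝ (Fin n)) (c : ι → ℝ)
    (x : EuclideanSpace ℝ (Fin n)) :
    ∀ᶠ x' in 𝓝 x, ∀ i, x' ∈ maxCell q c i → x ∈ maxCell q c i := by
  refine eventually_all.2 fun i => ?_
  by_cases hx : x ∈ maxCell q c i
  · exact Eventually.of_forall fun _ _ => hx
  · filter_upwards [(isClosed_maxCell q c i).isOpen_compl.mem_nhds hx] with x' hx' h
    exact absurd h hx'

/-- A small step in direction `d` activates no new term; the same holds for a step back. -/
lemma exists_step_active_subset [Finite ι] (q : ι → EuclideanSpace ℝ (Fin n)) (c : ι → ℝ)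
    (x d : EuclideanSpace ℝ (Fin n)) :
    ∃ ε : ℝ, 0 < ε ∧ ∀ i, (x + ε • d ∈ maxCell q c i → x ∈ maxCell q c i) ∧
      (x - ε • d ∈ maxCell q c i → x ∈ maxCell q c i) := by
  have h1 : Tendsto (fun ε : ℝ => x + ε • d) (𝓝[>] 0) (𝓝 x) := by
    have : ContinuousAt (fun ε : ℝ => x + ε • d) 0 := by fun_prop
    simpa [ContinuousAt] using this.tendsto.mono_left nhdsWithin_le_nhds
  have h2 : Tendsto (fun ε : ℝ => x - ε • d) (𝓝[>] 0) (𝓝 x) := by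
    have : ContinuousAt (fun ε : ℝ => x - ε • d) 0 := by fun_prop
    simpa [ContinuousAt] using this.tendsto.mono_left nhdsWithin_le_nhds
  obtain ⟨ε, ⟨e1, e2⟩, e3⟩ := (((h1.eventually (eventually_active_subset q c x)).and
    (h2.eventually (eventually_active_subset q c x))).and self_mem_nhdsWithin).exists
  exact ⟨ε, e3, fun i => ⟨e1 i, e2 i⟩⟩

lemma continuous_plMax [Fintype ι] [Nonempty ι] (q : ι → EuclideanSpace ℝ (Fin n)) (c : ι → ℝ) :
    Continuous (plMax q c) := by
  have : plMax q c = fun x => Finset.univ.sup' Finset.univ_nonempty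
      (fun i => inner ℝ x (q i) + c i) := by
    funext x
    simp [plMax, Finset.sup'_univ_eq_ciSup]
  rw [this]
  exact Continuous.finset_sup'_apply _ fun i _ => by fun_prop

/-- The convex hull of the slopes that are active at `x`: the subdifferential of the maximum. -/
def dualCell (q : ι → EuclideanSpace ℝ (Fin n)) (c : ι → ℝ) (x : EuclideanSpace ℝ (Fin n)) :
    Set (EuclideanSpace ℝ (Fin n)) :=
  convexHull ℝ (q '' {i | x ∈ maxCell q c i})

/-- The cells dual to the linearity domains of `plMax q c`, and the empty cell. -/
def dualSubdivision (q : ι → EuclideanSpace ℝ (Fin n)) (c : ι → ℝ) :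
    Set (Set (EuclideanSpace ℝ (Fin n))) :=
  insert ∅ (range (dualCell q c))

/-- The real-valued Legendre dual of `plMax q c`. -/
noncomputable def realDual (q : ι → EuclideanSpace ℝ (Fin n)) (c : ι → ℝ) (y : EuclideanSpace ℝ (Fin n)) : ℝ :=
  ⨆ x, (inner ℝ x y - plMax q c x)

lemma isCompact_dualCell [Finite ι] (q : ι → EuclideanSpace ℝ (Fin n)) (c : ι → ℝ)
    (x : EuclideanSpace ℝ (Fin n)) : IsCompact (dualCell q c x) :=
  ((Set.toFinite _).image q).isCompact_convexHull ℝ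

lemma dualCell_nonempty [Finite ι] [Nonempty ι] (q : ι → EuclideanSpace ℝ (Fin n)) (c : ι → ℝ)
    (x : EuclideanSpace ℝ (Fin n)) : (dualCell q c x).Nonempty := by
  obtain ⟨i, hi⟩ := exists_mem_maxCell q c x
  exact ⟨q i, subset_convexHull ℝ _ ⟨i, hi, rfl⟩⟩

/-- The condition says that `y` is a subgradient at `x`. If `y` were outside the hull, separate it
by `a` and step slightly along `a`: the slope active there was already active at `x`, so the maximum
grows too slowly along `a` for the subgradient inequality. -/
lemma mem_dualCell_iff [Finite ι] [Nonempty ι] :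
    y ∈ dualCell q c x ↔
      ∀ x', inner ℝ x' y - plMax q c x' ≤ inner ℝ x y - plMax q c x := by
  constructor
  · intro hy x'
    have : inner ℝ (x' - x) y ≤ plMax q c x' - plMax q c x := by
      refine inner_le_of_mem_convexHull ?_ hy
      rintro _ ⟨i, hi, rfl⟩
      have h1 := le_plMax q c x' i
      rw [mem_ofPred_eq, mem_maxCell_iff] at hi
      rw [inner_sub_left]
      linarith
    rw [inner_sub_left] at this
    linarith
  · intro h
    by_contra hy
    obtain ⟨a, r, h1, h2⟩ := exists_inner_lt_of_notMem (convex_convexHull ℝ _)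
      (isCompact_dualCell q c x).isClosed hy
    obtain ⟨ε, hε, hs⟩ := exists_step_active_subset q c x a
    obtain ⟨i, hi⟩ := exists_mem_maxCell q c (x + ε • a)
    have hi' := (hs i).1 hi
    have h3 := h1 (q i) (subset_convexHull ℝ _ ⟨i, hi', rfl⟩)
    have h4 := h (x + ε • a)
    rw [mem_maxCell_iff] at hi hi'
    rw [hi, hi'] at h4
    simp only [inner_add_left, real_inner_smul_left] at h4
    have := mul_lt_mul_of_pos_left (h3.trans h2) hε
    linarith

lemma dualCell_subset_convexHull (q : ι → EuclideanSpace ℝ (Fin n)) (c : ι → ℝ)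
    (x : EuclideanSpace ℝ (Fin n)) : dualCell q c x ⊆ convexHull ℝ (range q) :=
  convexHull_mono (image_subset_range _ _)

lemma inner_sub_plMax_le [Finite ι] {B : ℝ} (hB : ∀ i, -c i ≤ B)
    (hy : y ∈ convexHull ℝ (range q)) (x : EuclideanSpace ℝ (Fin n)) :
    inner ℝ x y - plMax q c x ≤ B := by
  have : inner ℝ x y ≤ B + plMax q c x := by
    refine inner_le_of_mem_convexHull ?_ hy
    rintro _ ⟨j, rfl⟩
    have := le_plMax q c x j
    have := hB j
    linarith
  linarith

lemma exists_upperBound_of_mem_convexHull [Finite ι] [Nonempty ι]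
    (q : ι → EuclideanSpace ℝ (Fin n)) (c : ι → ℝ) :
    ∃ B, ∀ y ∈ convexHull ℝ (range q), ∀ x, inner ℝ x y - plMax q c x ≤ B := by
  obtain ⟨i, hi⟩ := Finite.exists_max fun i => - c i
  exact ⟨-c i, fun y hy x => inner_sub_plMax_le hi hy x⟩

lemma le_realDual [Finite ι] [Nonempty ι] (hy : y ∈ convexHull ℝ (range q)) :
    inner ℝ x y - plMax q c x ≤ realDual q c y := by
  obtain ⟨B, hB⟩ := exists_upperBound_of_mem_convexHull q c
  exact le_ciSup (f := fun x => inner ℝ x y - plMax q c x)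
    ⟨B, by rintro _ ⟨x, rfl⟩; exact hB y hy x⟩ x

lemma realDual_eq_of_mem_dualCell [Finite ι] [Nonempty ι] (hy : y ∈ dualCell q c x) :
    realDual q c y = inner ℝ x y - plMax q c x :=
  le_antisymm (ciSup_le (mem_dualCell_iff.1 hy)) (le_realDual (dualCell_subset_convexHull q c x hy))

lemma convexOn_realDual [Finite ι] [Nonempty ι] (q : ι → EuclideanSpace ℝ (Fin n)) (c : ι → ℝ) :
    ConvexOn ℝ (convexHull ℝ (range q)) (realDual q c) := by
  refine ⟨convex_convexHull ℝ _, fun y hy z hz a b ha hb hab => ciSup_le fun x => ?_⟩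
  have h1 := mul_le_mul_of_nonneg_left (le_realDual (c := c) (x := x) hy) ha
  have h2 := mul_le_mul_of_nonneg_left (le_realDual (c := c) (x := x) hz) hb
  simp only [inner_add_right, real_inner_smul_right, smul_eq_mul]
  have e : plMax q c x = a * plMax q c x + b * plMax q c x := by rw [← add_mul, hab, one_mul]
  linarith

lemma legendreDual_eq_realDual [Finite ι] [Nonempty ι] (hy : y ∈ convexHull ℝ (range q)) :
    legendreDual (fun x => (plMax q c x : EReal)) y = (realDual q c y : EReal) := by
  obtain ⟨B, hB⟩ := exists_upperBound_of_mem_convexHull q c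
  refine le_antisymm (iSup_le fun x => ?_) ?_
  · rw [← EReal.coe_sub]
    exact EReal.coe_le_coe_iff.2 (le_realDual hy)
  · refine EReal.ge_of_forall_gt_iff_ge.1 fun r hr => ?_
    rw [EReal.coe_lt_coe_iff] at hr
    obtain ⟨x, hx⟩ := exists_lt_of_lt_ciSup hr
    refine le_iSup_of_le x ?_
    rw [← EReal.coe_sub]
    exact EReal.coe_le_coe_iff.2 hx.le

/-- Along the ray spanned by a separating vector `a`, the maximum grows at rate at most `r`, while
the pairing with `y` grows at a larger rate. -/
lemma legendreDual_eq_top [Finite ι] [Nonempty ι] (hy : y ∉ convexHull ℝ (range q)) :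
    legendreDual (fun x => (plMax q c x : EReal)) y = ⊤ := by
  obtain ⟨a, r, h1, h2⟩ := exists_inner_lt_of_notMem (convex_convexHull ℝ _)
    ((finite_range q).isCompact_convexHull ℝ).isClosed hy
  obtain ⟨i, hi⟩ := Finite.exists_max c
  rw [EReal.eq_top_iff_forall_lt]
  intro b
  obtain ⟨N, hN⟩ := exists_nat_gt ((b + c i) / (inner ℝ a y - r))
  rw [div_lt_iff₀ (by linarith)] at hN
  refine lt_of_lt_of_le ?_ (le_iSup _ ((N : ℝ) • a))
  rw [← EReal.coe_sub, EReal.coe_lt_coe_iff]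
  have : plMax q c ((N : ℝ) • a) ≤ N * r + c i := by
    refine plMax_le fun j => ?_
    rw [real_inner_smul_left]
    have := mul_le_mul_of_nonneg_left (h1 (q j) (subset_convexHull ℝ _ ⟨j, rfl⟩)).le
      (Nat.cast_nonneg (α := ℝ) N)
    have := hi j
    linarith
  rw [real_inner_smul_left]
  linarith

end PLMax

/-! ### Finitely generated cones and polytopes are polyhedral. -/

section Polyhedron

variable {V : Type*} [AddCommGroup V] [Module ℝ V]

/-- Fourier–Motzkin elimination: the sum of a polyhedral cone and a ray is polyhedral. -/
lemma exists_finite_halfSpaces_add_ray {S : Set (Module.Dual ℝ V)} (hS : S.Finite) (v : V) :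
    ∃ S' : Set (Module.Dual ℝ V), S'.Finite ∧
      ∀ y, (∀ f ∈ S', f y ≤ 0) ↔ ∃ t : ℝ, 0 ≤ t ∧ ∀ f ∈ S, f (y - t • v) ≤ 0 := by
  refine ⟨{f ∈ S | f v ≤ 0} ∪
    image2 (fun g f => (-f v) • g + (g v) • f) {g ∈ S | 0 < g v} {f ∈ S | f v < 0},
    (hS.subset (sep_subset _ _)).union
      ((hS.subset (sep_subset _ _)).image2 _ (hS.subset (sep_subset _ _))), fun y => ⟨?_, ?_⟩⟩
  · intro h
    have h1 : ∀ f ∈ S, f v ≤ 0 → f y ≤ 0 := fun f hf hv => h f (Or.inl ⟨hf, hv⟩)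
    have h2 : ∀ g ∈ S, 0 < g v → ∀ f ∈ S, f v < 0 → -f v * g y + g v * f y ≤ 0 :=
      fun g hg hgv f hf hfv => by
        simpa using h _ (Or.inr (mem_image2_of_mem (f := fun g f : Module.Dual ℝ V => (-f v) • g + (g v) • f)
          (⟨hg, hgv⟩ : g ∈ {g ∈ S | 0 < g v}) (⟨hf, hfv⟩ : f ∈ {f ∈ S | f v < 0})))
    -- The constraints with `g v > 0` bound `t` from below. The least admissible `t ≥ 0` is either 0
    -- or one of these bounds; in the latter case the combined inequalities `h2` give the
    -- constraints with `f v < 0`.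
    obtain ⟨t, ht0, ht1, ht2⟩ : ∃ t : ℝ, 0 ≤ t ∧ (∀ g ∈ S, 0 < g v → g y / g v ≤ t) ∧
        (t = 0 ∨ ∃ g ∈ S, 0 < g v ∧ t = g y / g v) := by
      rcases ({g ∈ S | 0 < g v}).eq_empty_or_nonempty with he | he
      · exact ⟨0, le_rfl, fun g hg hgv =>
          ((eq_empty_iff_forall_notMem.1 he) g ⟨hg, hgv⟩).elim, Or.inl rfl⟩
      · obtain ⟨g, hg, hm⟩ := exists_max_image _ (fun g : Module.Dual ℝ V => g y / g v)
          (hS.subset (sep_subset S fun g => 0 < g v)) he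
        rcases le_total 0 (g y / g v) with h0 | h0
        · exact ⟨_, h0, fun f hf hfv => hm f ⟨hf, hfv⟩, Or.inr ⟨g, hg.1, hg.2, rfl⟩⟩
        · exact ⟨0, le_rfl, fun f hf hfv => (hm f ⟨hf, hfv⟩).trans h0, Or.inl rfl⟩
    refine ⟨t, ht0, fun f hf => ?_⟩
    rw [map_sub, map_smul, smul_eq_mul]
    rcases lt_trichotomy (f v) 0 with hfv | hfv | hfv
    · rcases ht2 with rfl | ⟨g, hg, hgv, rfl⟩
      · simpa using h1 f hf hfv.le
      · have := h2 g hg hgv f hf hfv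
        have e : f y - g y / g v * f v = (-f v * g y + g v * f y) / g v := by
          field_simp
          ring
        rw [e]
        exact div_nonpos_of_nonpos_of_nonneg this hgv.le
    · simpa [hfv] using h1 f hf hfv.le
    · have := (div_le_iff₀ hfv).1 (ht1 f hf hfv)
      linarith
  · rintro ⟨t, ht, h⟩ f (⟨hf, hfv⟩ | ⟨g, ⟨hg, hgv⟩, f, ⟨hf, hfv⟩, rfl⟩)
    · have := h f hf
      rw [map_sub, map_smul, smul_eq_mul] at this
      have := mul_nonpos_of_nonneg_of_nonpos ht hfv
      linarith
    · have h1 := h f hf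
      have h2 := h g hg
      rw [map_sub, map_smul, smul_eq_mul] at h1 h2
      have h3 := mul_le_mul_of_nonneg_left h1 hgv.le
      have h4 := mul_le_mul_of_nonneg_left h2 (neg_pos.2 hfv).le
      simp only [LinearMap.add_apply, LinearMap.smul_apply, smul_eq_mul]
      nlinarith

/-- Minkowski–Weyl: a finitely generated cone is an intersection of finitely many half spaces. -/
lemma exists_finite_halfSpaces_span [FiniteDimensional ℝ V] {s : Set V} (hs : s.Finite) :
    ∃ S : Set (Module.Dual ℝ V), S.Finite ∧
      ∀ y, y ∈ Submodule.span {a : ℝ // 0 ≤ a} s ↔ ∀ f ∈ S, f y ≤ 0 := by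
  induction s, hs using Set.Finite.induction_on with
  | empty =>
    let b := Module.finBasis ℝ V
    refine ⟨range b.coord ∪ range fun i => -b.coord i,
      (finite_range _).union (finite_range _), fun y => ?_⟩
    rw [Submodule.span_empty, Submodule.mem_bot]
    constructor
    · rintro rfl f -
      simp
    · intro h
      refine b.ext_elem fun i => ?_
      have h1 := h _ (Or.inl ⟨i, rfl⟩)
      have h2 := h _ (Or.inr ⟨i, rfl⟩)
      simp at h1 h2 ⊢
      linarith
  | @insert v s _ _ ih =>
    obtain ⟨S, hS, h⟩ := ih
    obtain ⟨S', hS', h'⟩ := exists_finite_halfSpaces_add_ray hS v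
    refine ⟨S', hS', fun y => ?_⟩
    rw [h' y, Submodule.mem_span_insert]
    constructor
    · rintro ⟨a, z, hz, rfl⟩
      refine ⟨a, a.2, ?_⟩
      have : a • v + z - (a : ℝ) • v = z := by
        rw [show a • v = (a : ℝ) • v from rfl]
        abel
      rw [this]
      exact (h z).1 hz
    · rintro ⟨t, ht, hf⟩
      refine ⟨⟨t, ht⟩, y - t • v, (h _).2 hf, ?_⟩
      rw [show (⟨t, ht⟩ : {a : ℝ // 0 ≤ a}) • v = t • v from rfl]
      abel

/-- Homogenization: the hull is the slice at height 1 of the cone over `s × {1}`. -/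
lemma mem_convexHull_iff_mem_span {s : Set V} {y : V} :
    y ∈ convexHull ℝ s ↔
      (y, (1 : ℝ)) ∈ Submodule.span {a : ℝ // 0 ≤ a} ((fun z => (z, (1 : ℝ))) '' s) := by
  set C : Submodule {a : ℝ // 0 ≤ a} (V × ℝ) :=
    Submodule.span {a : ℝ // 0 ≤ a} ((fun z => (z, (1 : ℝ))) '' s) with hC
  constructor
  · have hc : Convex ℝ {z : V | (z, (1 : ℝ)) ∈ C} := by
      intro z (hz : (z, (1 : ℝ)) ∈ C) w (hw : (w, (1 : ℝ)) ∈ C) a b ha hb hab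
      have := add_mem (C.smul_mem (⟨a, ha⟩ : {a : ℝ // 0 ≤ a}) hz)
        (C.smul_mem (⟨b, hb⟩ : {a : ℝ // 0 ≤ a}) hw)
      have e : (⟨a, ha⟩ : {a : ℝ // 0 ≤ a}) • (z, (1 : ℝ)) +
          (⟨b, hb⟩ : {a : ℝ // 0 ≤ a}) • (w, (1 : ℝ)) = (a • z + b • w, (1 : ℝ)) := by
        refine Prod.ext rfl ?_
        change a * 1 + b * 1 = (1 : ℝ)
        rw [mul_one, mul_one, hab]
      rwa [e] at this
    have hs : s ⊆ {z : V | (z, (1 : ℝ)) ∈ C} := fun z hz =>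
      Submodule.subset_span (mem_image_of_mem (fun z => (z, (1 : ℝ))) hz)
    exact fun h => convexHull_min hs hc h
  · intro h
    -- An invariant stable under the cone operations: a nonzero element has positive height, and
    -- rescaling it to height 1 lands in the hull.
    have key : ∀ z ∈ C, z = 0 ∨ (0 < z.2 ∧ z.2⁻¹ • z.1 ∈ convexHull ℝ s) := by
      intro z hz
      induction hz using Submodule.span_induction with
      | mem x hx =>
        obtain ⟨z, hz, rfl⟩ := hx
        exact Or.inr ⟨one_pos, by simpa using subset_convexHull ℝ s hz⟩
      | zero => exact Or.inl rfl
      | add z w _ _ hz hw =>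
        rcases hz with rfl | ⟨hz, hz'⟩
        · simpa using hw
        rcases hw with rfl | ⟨hw, hw'⟩
        · exact Or.inr (by simpa using ⟨hz, hz'⟩)
        have hp : 0 < z.2 + w.2 := add_pos hz hw
        refine Or.inr ⟨hp, ?_⟩
        have := convex_convexHull ℝ s hz' hw' (a := z.2 / (z.2 + w.2)) (b := w.2 / (z.2 + w.2))
          (by positivity) (by positivity) (by field_simp)
        convert this using 1
        rw [smul_smul, smul_smul, Prod.fst_add, Prod.snd_add, smul_add]
        congr 2 <;> field_simp
      | smul a z _ hz =>
        rcases hz with rfl | ⟨hz, hz'⟩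
        · simp
        rcases a.2.eq_or_lt with ha | ha
        · left
          rw [show a = 0 from Subtype.ext ha.symm, zero_smul]
        · refine Or.inr ⟨mul_pos ha hz, ?_⟩
          convert hz' using 1
          change ((a : ℝ) * z.2)⁻¹ • ((a : ℝ) • z.1) = _
          rw [smul_smul]
          congr 1
          field_simp
    rcases key _ h with h0 | ⟨-, h1⟩
    · simp at h0
    · simpa using h1

end Polyhedron

lemma isConvexPolyhedron_convexHull {n : ℕ} {s : Set (EuclideanSpace ℝ (Fin n))}
    (hs : s.Finite) : IsConvexPolyhedron (convexHull ℝ s) := by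
  obtain ⟨S, hS, h⟩ := exists_finite_halfSpaces_span (hs.image fun z => (z, (1 : ℝ)))
  obtain ⟨N, f, rfl⟩ := hS.fin_embedding
  have hrep : ∀ i, ∃ a : EuclideanSpace ℝ (Fin n), ∀ y, inner ℝ a y = f i (y, 0) := fun i =>
    ⟨(InnerProductSpace.toDual ℝ _).symm
      (LinearMap.toContinuousLinearMap (f i ∘ₗ LinearMap.inl ℝ _ ℝ)), fun y => by simp⟩
  choose a ha using hrep
  refine ⟨N, a, fun i => -f i (0, 1), ?_⟩
  ext y
  rw [mem_convexHull_iff_mem_span, h]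
  simp only [forall_mem_range, mem_ofPred_eq, ha]
  refine forall_congr' fun i => ?_
  rw [show ((y, 1) : EuclideanSpace ℝ (Fin n) × ℝ) = (y, 0) + (0, 1) by simp, map_add]
  constructor <;> intro _ <;> linarith

lemma isConvexPolyhedron_empty {n : ℕ} :
    IsConvexPolyhedron (∅ : Set (EuclideanSpace ℝ (Fin n))) := by
  simpa using isConvexPolyhedron_convexHull (n := n) (finite_empty)

/-! ### The dual cell decomposition and its discrete Hessian determinant. -/

section Subdivision

variable {n : ℕ} {ι : Type*} {q : ι → EuclideanSpace ℝ (Fin n)} {c : ι → ℝ}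
  {x y : EuclideanSpace ℝ (Fin n)}

/-- Above an interior point of its domain, the dual problem is coercive. -/
lemma exists_coercive [Finite ι] (hy : y ∈ interior (convexHull ℝ (range q))) :
    ∃ r : ℝ, 0 < r ∧ ∀ (c : ι → ℝ) (B : ℝ), (∀ i, -c i ≤ B) →
      ∀ x, inner ℝ x y + r * ‖x‖ ≤ plMax q c x + B := by
  obtain ⟨r, hr, hb⟩ := Metric.mem_nhds_iff.1 (mem_interior_iff_mem_nhds.1 hy)
  refine ⟨r / 2, half_pos hr, fun c B hB x => ?_⟩
  rcases eq_or_ne x 0 with rfl | hx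
  · have := inner_sub_plMax_le hB (interior_subset hy) 0
    simp at this ⊢
    linarith
  · have hx' : 0 < ‖x‖ := norm_pos_iff.2 hx
    have hmem : y + (r / 2 / ‖x‖) • x ∈ convexHull ℝ (range q) := by
      refine hb ?_
      rw [Metric.mem_ball, dist_eq_norm, add_sub_cancel_left, norm_smul, Real.norm_eq_abs,
        abs_of_pos (by positivity), div_mul_cancel₀ _ hx'.ne']
      linarith
    have := inner_sub_plMax_le hB hmem x
    rw [inner_add_right, real_inner_smul_right, real_inner_self_eq_norm_sq] at this
    have e : r / 2 / ‖x‖ * ‖x‖ ^ 2 = r / 2 * ‖x‖ := by field_simp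
    linarith

/-- By coercivity `plMax q c x - x · y` attains its minimum, and `y` is a subgradient at any
minimizer. -/
lemma exists_mem_dualCell_of_mem_interior [Finite ι] [Nonempty ι] (c : ι → ℝ)
    (hy : y ∈ interior (convexHull ℝ (range q))) : ∃ x, y ∈ dualCell q c x := by
  have := Fintype.ofFinite ι
  obtain ⟨r, hr, h⟩ := exists_coercive hy
  obtain ⟨i, hi⟩ := Finite.exists_max fun i => - c i
  have hcont : Continuous fun x => plMax q c x - inner ℝ x y :=
    (continuous_plMax q c).sub (by fun_prop)
  have hlim : Tendsto (fun x => plMax q c x - inner ℝ x y) (cocompact _) atTop := by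
    have h1 : Tendsto (fun x : EuclideanSpace ℝ (Fin n) => r * ‖x‖ - (-c i))
        (cocompact _) atTop :=
      tendsto_atTop_add_const_right _ _ (tendsto_norm_cocompact_atTop.const_mul_atTop hr)
    refine tendsto_atTop_mono (fun x => ?_) h1
    have := h c _ hi x
    linarith
  obtain ⟨x, hx⟩ := hcont.exists_forall_le hlim
  refine ⟨x, mem_dualCell_iff.2 fun x' => ?_⟩
  have := hx x'
  linarith

lemma finite_range_dualCell [Finite ι] (q : ι → EuclideanSpace ℝ (Fin n)) (c : ι → ℝ) :
    (range (dualCell q c)).Finite := by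
  refine (Set.finite_range fun s : Set ι => convexHull ℝ (q '' s)).subset ?_
  rintro _ ⟨x, rfl⟩
  exact ⟨_, rfl⟩

/-- The union is closed, being finite, and contains the interior of the hull, whose closure contains
the hull. -/
lemma iUnion_dualCell [Finite ι] [Nonempty ι] (c : ι → ℝ)
    (hq : (interior (convexHull ℝ (range q))).Nonempty) :
    ⋃ x, dualCell q c x = convexHull ℝ (range q) := by
  refine (iUnion_subset fun x => dualCell_subset_convexHull q c x).antisymm ?_
  have hcl : IsClosed (⋃ x, dualCell q c x) := by
    rw [← sUnion_range, sUnion_eq_biUnion]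
    refine (finite_range_dualCell q c).isClosed_biUnion ?_
    rintro _ ⟨x, rfl⟩
    exact (isCompact_dualCell q c x).isClosed
  have hint : interior (convexHull ℝ (range q)) ⊆ ⋃ x, dualCell q c x := fun y hy =>
    mem_iUnion.2 (exists_mem_dualCell_of_mem_interior c hy)
  calc convexHull ℝ (range q) ⊆ closure (convexHull ℝ (range q)) := subset_closure
    _ = closure (interior (convexHull ℝ (range q))) :=
      ((convex_convexHull ℝ _).closure_interior_eq_closure_of_nonempty_interior hq).symm
    _ ⊆ _ := closure_minimal hint hcl

/-- The direction `x' - x` exposes the intersection: on the cell of `x` its pairing is at most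
`plMax q c x' - plMax q c x`, with equality exactly on the cell of `x'`. -/
lemma isExposed_inter_dualCell [Finite ι] [Nonempty ι] (q : ι → EuclideanSpace ℝ (Fin n))
    (c : ι → ℝ) (x x' : EuclideanSpace ℝ (Fin n)) :
    IsExposed ℝ (dualCell q c x) (dualCell q c x ∩ dualCell q c x') := by
  rintro ⟨y₀, hy₀, hy₀'⟩
  refine ⟨innerSL ℝ (x' - x), ?_⟩
  have key : ∀ y ∈ dualCell q c x, inner ℝ (x' - x) y ≤ plMax q c x' - plMax q c x ∧
      (y ∈ dualCell q c x' ↔ plMax q c x' - plMax q c x ≤ inner ℝ (x' - x) y) := by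
    intro y hy
    have h1 := mem_dualCell_iff.1 hy
    rw [inner_sub_left]
    refine ⟨by linarith [h1 x'], ?_, ?_⟩
    · intro h
      linarith [mem_dualCell_iff.1 h x]
    · intro h
      exact mem_dualCell_iff.2 fun z => by linarith [h1 z]
  ext y
  constructor
  · rintro ⟨hy, hy'⟩
    exact ⟨hy, fun z hz => (key z hz).1.trans ((key y hy).2.1 hy')⟩
  · rintro ⟨hy, hy'⟩
    exact ⟨hy, (key y hy).2.2 (((key y₀ hy₀).2.1 hy₀').trans (hy' y₀ hy₀))⟩

/-- The face exposed by `a` is the cell of `x + ε • a` for small `ε`: the slopes active after the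
step are those active at `x` that maximize the pairing with `a`. -/
lemma exists_eq_dualCell_of_isExposed [Finite ι] [Nonempty ι]
    {τ : Set (EuclideanSpace ℝ (Fin n))} (h : IsExposed ℝ (dualCell q c x) τ)
    (hτ : τ.Nonempty) : ∃ x', τ = dualCell q c x' := by
  obtain ⟨l, rfl⟩ := h hτ
  obtain ⟨a, rfl⟩ : ∃ a, l = innerSL ℝ a :=
    ⟨(InnerProductSpace.toDual ℝ _).symm l, by ext; simp⟩
  obtain ⟨ε, hε, hs⟩ := exists_step_active_subset q c x a
  have hu : ∀ i, x + ε • a ∈ maxCell q c i →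
      plMax q c (x + ε • a) = plMax q c x + ε * inner ℝ a (q i) := by
    intro i hi
    have hi' := (hs i).1 hi
    rw [mem_maxCell_iff] at hi hi'
    rw [hi, hi', inner_add_left, real_inner_smul_left]
    ring
  obtain ⟨i₀, hi₀⟩ := exists_mem_maxCell q c (x + ε • a)
  have hle : ∀ z ∈ dualCell q c x, inner ℝ a z ≤ inner ℝ a (q i₀) := by
    intro z hz
    refine inner_le_of_mem_convexHull ?_ hz
    rintro _ ⟨j, hj, rfl⟩
    have h1 := le_plMax q c (x + ε • a) j
    rw [hu i₀ hi₀, mem_maxCell_iff.1 hj, inner_add_left, real_inner_smul_left] at h1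
    exact le_of_mul_le_mul_left (by linarith) hε
  refine ⟨x + ε • a, Subset.antisymm ?_ ?_⟩
  · rintro y ⟨hy, hmax⟩
    have h1 : inner ℝ a (q i₀) ≤ inner ℝ a y :=
      hmax _ (subset_convexHull ℝ _ ⟨i₀, (hs i₀).1 hi₀, rfl⟩)
    refine mem_dualCell_iff.2 fun x' => ?_
    have h2 := mem_dualCell_iff.1 hy x'
    rw [hu i₀ hi₀, inner_add_left, real_inner_smul_left]
    have := mul_le_mul_of_nonneg_left h1 hε.le
    linarith
  · intro y hy
    refine ⟨convexHull_mono (image_mono fun i hi => (hs i).1 hi) hy, fun z hz => ?_⟩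
    have : inner ℝ (-a) y ≤ -inner ℝ a (q i₀) := by
      refine inner_le_of_mem_convexHull ?_ hy
      rintro _ ⟨j, hj, rfl⟩
      have h1 := hu j hj
      rw [hu i₀ hi₀] at h1
      have := mul_left_cancel₀ hε.ne' (add_left_cancel h1)
      rw [inner_neg_left, this]
    rw [inner_neg_left] at this
    simp only [innerSL_apply_apply]
    linarith [hle z hz]

theorem isConvexSubdivision_dualSubdivision [Finite ι] [Nonempty ι] (c : ι → ℝ)
    (hq : (interior (convexHull ℝ (range q))).Nonempty) :
    IsConvexSubdivision (convexHull ℝ (range q)) (dualSubdivision q c) where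
  finite := (finite_range_dualCell q c).insert _
  polyhedron := by
    rintro σ (rfl | ⟨x, rfl⟩)
    · exact isConvexPolyhedron_empty
    · exact isConvexPolyhedron_convexHull (toFinite _)
  cover := by
    rw [dualSubdivision, sUnion_insert, sUnion_range, empty_union, iUnion_dualCell c hq]
  inter := by
    rintro σ (rfl | ⟨x, rfl⟩) τ (rfl | ⟨x', rfl⟩)
    · exact Or.inl (by simp)
    · exact Or.inl (by simp)
    · exact Or.inl (by simp)
    · rcases (dualCell q c x ∩ dualCell q c x').eq_empty_or_nonempty with h | h
      · exact Or.inl h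
      · obtain ⟨z, hz⟩ := exists_eq_dualCell_of_isExposed (isExposed_inter_dualCell q c x x') h
        exact Or.inr ⟨z, hz.symm⟩
  face := by
    rintro σ (rfl | ⟨x, rfl⟩) τ hτ
    · rw [subset_empty_iff] at hτ
      subst hτ
      exact ⟨fun _ => IsExposed.refl _, fun _ => Or.inl rfl⟩
    · constructor
      · rintro (rfl | ⟨x', rfl⟩)
        · exact isExposed_empty
        · simpa [inter_eq_right.2 hτ] using isExposed_inter_dualCell q c x x'
      · intro h
        rcases τ.eq_empty_or_nonempty with rfl | hne
        · exact Or.inl rfl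
        · obtain ⟨z, hz⟩ := exists_eq_dualCell_of_isExposed h hne
          exact Or.inr ⟨z, hz.symm⟩

theorem vertices_dualSubdivision [Finite ι] [Nonempty ι]
    (h : ∀ i, ∃ x, ∀ j, j ≠ i → inner ℝ x (q j) + c j < inner ℝ x (q i) + c i) :
    vertices (dualSubdivision q c) = range q := by
  ext z
  constructor
  · rintro (hz | ⟨x, hx⟩)
    · exact absurd hz (singleton_ne_empty z)
    · obtain ⟨i, hi⟩ := exists_mem_maxCell q c x
      have : q i ∈ dualCell q c x := subset_convexHull ℝ _ ⟨i, hi, rfl⟩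
      rw [hx] at this
      exact ⟨i, this⟩
  · rintro ⟨i, rfl⟩
    obtain ⟨x, hx⟩ := h i
    refine Or.inr ⟨x, ?_⟩
    have : {j | x ∈ maxCell q c j} = {i} := by
      ext j
      constructor
      · intro hj
        by_contra hne
        exact (hx j hne).not_ge (hj i)
      · rintro rfl k
        rcases eq_or_ne k j with rfl | hk
        · exact le_rfl
        · exact (hx k hk).le
    rw [dualCell, this, image_singleton, convexHull_singleton]

lemma hasGradientOnCell_dualCell [Finite ι] [Nonempty ι] (q : ι → EuclideanSpace ℝ (Fin n))
    (c : ι → ℝ) (x : EuclideanSpace ℝ (Fin n)) :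
    HasGradientOnCell (realDual q c) (dualCell q c x) x :=
  ⟨-plMax q c x, fun _ hy => by rw [realDual_eq_of_mem_dualCell hy, sub_eq_add_neg]⟩

theorem isPLConvexOn_realDual [Finite ι] [Nonempty ι] (q : ι → EuclideanSpace ℝ (Fin n))
    (c : ι → ℝ) :
    IsPLConvexOn (convexHull ℝ (range q)) (dualSubdivision q c) (realDual q c) := by
  refine ⟨convexOn_realDual q c, ?_⟩
  rintro σ (rfl | ⟨x, rfl⟩)
  · exact ⟨0, 0, by simp⟩
  · exact ⟨x, hasGradientOnCell_dualCell q c x⟩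

/-- Compare the two affine formulas at an interior point and at a nearby point in direction `a - b`.
-/
lemma HasGradientOnCell.unique {w : EuclideanSpace ℝ (Fin n) → ℝ}
    {σ : Set (EuclideanSpace ℝ (Fin n))} {a b : EuclideanSpace ℝ (Fin n)}
    (hσ : (interior σ).Nonempty) (ha : HasGradientOnCell w σ a) (hb : HasGradientOnCell w σ b) :
    a = b := by
  obtain ⟨ca, ha⟩ := ha
  obtain ⟨cb, hb⟩ := hb
  obtain ⟨y, hy⟩ := hσ
  have h1 : Tendsto (fun ε : ℝ => y + ε • (a - b)) (𝓝[>] 0) (𝓝 y) := by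
    have : ContinuousAt (fun ε : ℝ => y + ε • (a - b)) 0 := by fun_prop
    simpa [ContinuousAt] using this.tendsto.mono_left nhdsWithin_le_nhds
  obtain ⟨ε, h2, hε⟩ := ((h1.eventually (isOpen_interior.mem_nhds hy)).and
    self_mem_nhdsWithin).exists
  have e1 := ha y (interior_subset hy)
  have e2 := hb y (interior_subset hy)
  have e3 := ha _ (interior_subset h2)
  have e4 := hb _ (interior_subset h2)
  simp only [inner_add_right, real_inner_smul_right] at e3 e4
  have h0 : ε * inner ℝ (a - b) (a - b) = 0 := by
    rw [inner_sub_left]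
    linarith
  rw [mul_eq_zero, inner_self_eq_zero, sub_eq_zero] at h0
  exact h0.resolve_left (ne_of_gt hε)

/-- A slope could lie in the hull of the active ones without being active. This is excluded once
term `i` is active at some `x'`: the subgradient inequality against `x'` then makes it active at
`x`. -/
lemma mem_dualCell_iff_mem_maxCell [Finite ι] [Nonempty ι] {i : ι}
    (h : (maxCell q c i).Nonempty) : q i ∈ dualCell q c x ↔ x ∈ maxCell q c i := by
  refine ⟨fun hx => ?_, fun hx => subset_convexHull ℝ _ ⟨i, hx, rfl⟩⟩
  obtain ⟨x', hx'⟩ := h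
  have h1 := mem_dualCell_iff.1 hx x'
  have h2 := le_plMax q c x i
  rw [mem_maxCell_iff] at hx' ⊢
  linarith

lemma realDual_apply_eq_neg [Finite ι] [Nonempty ι] {i : ι} (h : (maxCell q c i).Nonempty) :
    realDual q c (q i) = -c i := by
  obtain ⟨x, hx⟩ := h
  rw [realDual_eq_of_mem_dualCell (subset_convexHull ℝ _ ⟨i, hx, rfl⟩), mem_maxCell_iff.1 hx]
  ring

lemma isBounded_maxCell [Finite ι] [Nonempty ι] (c : ι → ℝ) {i : ι}
    (hi : q i ∈ interior (convexHull ℝ (range q))) : Bornology.IsBounded (maxCell q c i) := by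
  obtain ⟨r, hr, h⟩ := exists_coercive hi
  obtain ⟨j, hj⟩ := Finite.exists_max fun i => - c i
  refine isBounded_iff_forall_norm_le.2 ⟨(c i - c j) / r, fun x hx => ?_⟩
  have := h c _ hj x
  rw [mem_maxCell_iff.1 hx] at this
  rw [le_div_iff₀ hr]
  linarith

/-- If the slopes active at `x` failed to span affinely, some `d ≠ 0` would be orthogonal to all
their differences. Then `x ± ε • d` would both stay in the domain, contradicting extremality. -/
lemma interior_dualCell_nonempty_of_extreme [Finite ι] [Nonempty ι] {i : ι}
    (hx : x ∈ (maxCell q c i).extremePoints ℝ) : (interior (dualCell q c x)).Nonempty := by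
  rw [dualCell, interior_convexHull_nonempty_iff_affineSpan_eq_top]
  by_contra hne
  have hxi := hx.1
  set S := q '' {j | x ∈ maxCell q c j} with hS
  have hqi : q i ∈ affineSpan ℝ S := subset_affineSpan ℝ S ⟨i, hxi, rfl⟩
  have hdir : (affineSpan ℝ S).direction ≠ ⊤ := by
    intro h
    exact hne ((AffineSubspace.direction_eq_top_iff_of_nonempty ⟨_, hqi⟩).1 h)
  obtain ⟨d, hd, hd0⟩ := Submodule.exists_mem_ne_zero_of_ne_bot
    (mt (Submodule.orthogonal_eq_bot_iff).1 hdir)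
  have hperp : ∀ j, x ∈ maxCell q c j → inner ℝ d (q j) = inner ℝ d (q i) := by
    intro j hj
    have h1 : q j -ᵥ q i ∈ (affineSpan ℝ S).direction :=
      AffineSubspace.vsub_mem_direction (subset_affineSpan ℝ S ⟨j, hj, rfl⟩) hqi
    have := (Submodule.mem_orthogonal' _ _).1 hd _ h1
    rwa [vsub_eq_sub, inner_sub_right, sub_eq_zero] at this
  obtain ⟨ε, hε, hs⟩ := exists_step_active_subset q c x d
  have hplus : x + ε • d ∈ maxCell q c i := by
    obtain ⟨j, hj⟩ := exists_mem_maxCell q c (x + ε • d)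
    have hj' := (hs j).1 hj
    have h1 := hperp j hj'
    rw [mem_maxCell_iff] at hj hj' hxi ⊢
    rw [hj]
    simp only [inner_add_left, real_inner_smul_left, h1]
    linarith
  have hminus : x - ε • d ∈ maxCell q c i := by
    obtain ⟨j, hj⟩ := exists_mem_maxCell q c (x - ε • d)
    have hj' := (hs j).2 hj
    have h1 := hperp j hj'
    rw [mem_maxCell_iff] at hj hj' hxi ⊢
    rw [hj]
    simp only [inner_sub_left, real_inner_smul_left, h1]
    linarith
  have hseg : x ∈ openSegment ℝ (x + ε • d) (x - ε • d) :=
    ⟨1 / 2, 1 / 2, by norm_num, by norm_num, by norm_num, by module⟩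
  have := hx.2 hplus hminus hseg
  rw [add_eq_left, smul_eq_zero] at this
  exact this.elim hε.ne' hd0

/-- The discrete Hessian determinant at an interior vertex is the volume of the dual polytope. -/
theorem discreteHessianDet_dualSubdivision [Finite ι] [Nonempty ι] {i : ι}
    (hi : q i ∈ interior (convexHull ℝ (range q))) (hne : (maxCell q c i).Nonempty) :
    discreteHessianDet (dualSubdivision q c) (realDual q c) (q i) = volume (maxCell q c i) := by
  rw [discreteHessianDet]
  set G := {a | ∃ σ ∈ dualSubdivision q c, (interior σ).Nonempty ∧ q i ∈ σ ∧
    HasGradientOnCell (realDual q c) σ a} with hG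
  have h1 : G ⊆ maxCell q c i := by
    rintro a ⟨σ, (rfl | ⟨x, rfl⟩), hσ, hqi, ha⟩
    · exact hqi.elim
    · rw [ha.unique hσ (hasGradientOnCell_dualCell q c x)]
      exact (mem_dualCell_iff_mem_maxCell hne).1 hqi
  have h2 : (maxCell q c i).extremePoints ℝ ⊆ G := fun x hx =>
    ⟨_, Or.inr ⟨x, rfl⟩, interior_dualCell_nonempty_of_extreme hx,
      subset_convexHull ℝ _ ⟨i, hx.1, rfl⟩, hasGradientOnCell_dualCell q c x⟩
  have hcl := isClosed_maxCell q c i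
  -- Krein–Milman gives equality up to closure, which suffices because frontiers of convex sets are
  -- null.
  have h3 : closure (convexHull ℝ G) = maxCell q c i := by
    refine (closure_minimal (convexHull_min h1 (convex_maxCell q c i)) hcl).antisymm ?_
    conv_lhs => rw [← closure_convexHull_extremePoints
      (Metric.isCompact_of_isClosed_isBounded hcl (isBounded_maxCell c hi)) (convex_maxCell q c i)]
    exact closure_mono (convexHull_mono h2)
  rw [← h3, measure_closure_of_null_frontier ((convex_convexHull ℝ G).addHaar_frontier volume)]

end Subdivision

/-! ### Positive volume as strict dominance. -/

section StrictCells

variable {n : ℕ} {ι : Type*} {q : ι → EuclideanSpace ℝ (Fin n)} {c : ι → ℝ}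
  {x : EuclideanSpace ℝ (Fin n)} {i : ι}

lemma inner_lt_of_mem_interior {E : Type*} [NormedAddCommGroup E] [InnerProductSpace ℝ E]
    {s : Set E} {a y : E} {b : ℝ} (ha : a ≠ 0) (h : ∀ z ∈ s, inner ℝ a z ≤ b)
    (hy : y ∈ interior s) : inner ℝ a y < b := by
  have h1 : Tendsto (fun ε : ℝ => y + ε • a) (𝓝[>] 0) (𝓝 y) := by
    have : ContinuousAt (fun ε : ℝ => y + ε • a) 0 := by fun_prop
    simpa [ContinuousAt] using this.tendsto.mono_left nhdsWithin_le_nhds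
  obtain ⟨ε, h2, hε⟩ := ((h1.eventually (isOpen_interior.mem_nhds hy)).and
    self_mem_nhdsWithin).exists
  have h3 := h _ (interior_subset h2)
  rw [inner_add_right, real_inner_smul_right] at h3
  have := mul_pos (mem_Ioi.1 hε) (real_inner_self_pos.2 ha)
  linarith

lemma strict_of_mem_interior_maxCell (hq : Function.Injective q)
    (hx : x ∈ interior (maxCell q c i)) (j : ι) (hj : j ≠ i) :
    inner ℝ x (q j) + c j < inner ℝ x (q i) + c i := by
  have h1 := inner_lt_of_mem_interior (a := q j - q i) (b := c i - c j)
    (sub_ne_zero.2 (hq.ne hj)) (fun z hz => ?_) hx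
  · rw [real_inner_comm, inner_sub_right] at h1
    linarith
  · have := hz j
    rw [real_inner_comm, inner_sub_right]
    linarith

lemma ae_mem_interior_maxCell [Finite ι] [Nonempty ι] (q : ι → EuclideanSpace ℝ (Fin n))
    (c : ι → ℝ) : ∀ᵐ x, ∃ i, x ∈ interior (maxCell q c i) := by
  have h : ∀ᵐ x, ∀ i, x ∉ frontier (maxCell q c i) := ae_all_iff.2 fun i =>
    measure_eq_zero_iff_ae_notMem.1 ((convex_maxCell q c i).addHaar_frontier volume)
  filter_upwards [h] with x hx
  obtain ⟨i, hi⟩ := exists_mem_maxCell q c x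
  refine ⟨i, by_contra fun hn => hx i ⟨subset_closure hi, hn⟩⟩

lemma isOpen_strict [Finite ι] (q : ι → EuclideanSpace ℝ (Fin n)) (c : ι → ℝ) (i : ι) :
    IsOpen {x | ∀ j, j ≠ i → inner ℝ x (q j) + c j < inner ℝ x (q i) + c i} := by
  simp only [ofPred_forall]
  exact isOpen_iInter_of_finite fun j => isOpen_iInter_of_finite fun _ =>
    isOpen_lt (by fun_prop) (by fun_prop)

/-- This trades volume for strict linear inequalities, from which openness and convexity of
`admissible` can be read off. A convex set without interior is null; distinct slopes make the
inequalities strict at interior points. -/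
lemma volume_maxCell_pos_iff [Finite ι] [Nonempty ι] (hq : Function.Injective q) :
    0 < volume (maxCell q c i) ↔
      ∃ x, ∀ j, j ≠ i → inner ℝ x (q j) + c j < inner ℝ x (q i) + c i := by
  constructor
  · intro h
    rcases (interior (maxCell q c i)).eq_empty_or_nonempty with he | ⟨x, hx⟩
    · refine absurd (measure_mono_null ?_ ((convex_maxCell q c i).addHaar_frontier volume)) h.ne'
      rw [(isClosed_maxCell q c i).frontier_eq, he, sdiff_empty]
    · exact ⟨x, strict_of_mem_interior_maxCell hq hx⟩
  · rintro ⟨x, hx⟩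
    refine ((isOpen_strict q c i).measure_pos volume ⟨x, hx⟩).trans_le (measure_mono ?_)
    intro z hz j
    rcases eq_or_ne j i with rfl | hj
    · exact le_rfl
    · exact (hz j hj).le

end StrictCells

/-! ### The sites `p`, `v` and the admissible heights. -/

section Sites

variable {n k m : ℕ} {v : Fin m → EuclideanSpace ℝ (Fin n)} {p : Fin k → EuclideanSpace ℝ (Fin n)}

lemma continuous_heights (g : Fin m → ℝ) (s : Fin k ⊕ Fin m) :
    Continuous fun h : EuclideanSpace ℝ (Fin k) => heights g h s := by
  cases s <;> simp only [heights, Sum.elim_inl, Sum.elim_inr] <;> fun_prop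

lemma heights_combo (g : Fin m → ℝ) (h h' : EuclideanSpace ℝ (Fin k)) {a b : ℝ}
    (hab : a + b = 1) (s : Fin k ⊕ Fin m) :
    heights g (a • h + b • h') s = a * heights g h s + b * heights g h' s := by
  cases s with
  | inl j => simp [heights]
  | inr i =>
    simp only [heights, Sum.elim_inr]
    rw [← add_mul, hab, one_mul]

lemma convexHull_range_sites (hp : ∀ j, p j ∈ convexHull ℝ (range v)) :
    convexHull ℝ (range (sites p v)) = convexHull ℝ (range v) := by
  refine (convexHull_min ?_ (convex_convexHull ℝ _)).antisymm (convexHull_mono ?_)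
  · rintro _ ⟨j | i, rfl⟩
    · exact hp j
    · exact subset_convexHull ℝ _ ⟨i, rfl⟩
  · rintro _ ⟨i, rfl⟩
    exact ⟨Sum.inr i, rfl⟩

/-- A vertex is exposed strictly among all sites. -/
lemma exists_inner_sites_lt (hn : 0 < n)
    (hdim : (interior (convexHull ℝ (range v))).Nonempty)
    (hv : ∀ i, v i ∉ convexHull ℝ (v '' {i' | i' ≠ i}))
    (hp : ∀ j, p j ∈ interior (convexHull ℝ (range v))) (i : Fin m) :
    ∃ a, ∀ s, s ≠ Sum.inr i → inner ℝ a (sites p v s) < inner ℝ a (v i) := by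
  obtain ⟨a, r, h1, h2⟩ := exists_inner_lt_of_notMem (convex_convexHull ℝ _)
    ((toFinite (v '' {i' | i' ≠ i})).isCompact_convexHull ℝ).isClosed (hv i)
  have hlt : ∀ i', i' ≠ i → inner ℝ a (v i') < inner ℝ a (v i) := fun i' hi' =>
    (h1 _ (subset_convexHull ℝ _ ⟨i', hi', rfl⟩)).trans h2
  -- The case `a = 0` can only come from `m = 1`; the polytope would then be a point, without
  -- interior since `n > 0`.
  have ha : a ≠ 0 := by
    rintro rfl
    have hall : ∀ i', i' = i := fun i' => by
      by_contra hne
      simpa using hlt i' hne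
    have : range v = {v i} := by
      ext z
      constructor
      · rintro ⟨i', rfl⟩
        rw [hall i']
        rfl
      · rintro rfl
        exact ⟨i, rfl⟩
    have : Nonempty (Fin n) := ⟨⟨0, hn⟩⟩
    simp_all
  refine ⟨a, ?_⟩
  rintro (j | i') hs
  · refine inner_lt_of_mem_interior ha (fun z hz => inner_le_of_mem_convexHull ?_ hz) (hp j)
    rintro _ ⟨i', rfl⟩
    rcases eq_or_ne i' i with rfl | hi'
    · exact le_rfl
    · exact (hlt i' hi').le
  · exact hlt i' fun h => hs (by rw [h])

lemma injective_sites (hn : 0 < n)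
    (hdim : (interior (convexHull ℝ (range v))).Nonempty)
    (hv : ∀ i, v i ∉ convexHull ℝ (v '' {i' | i' ≠ i}))
    (hp : ∀ j, p j ∈ interior (convexHull ℝ (range v))) (hpinj : Function.Injective p) :
    Function.Injective (sites p v) := by
  have key : ∀ i s, s ≠ Sum.inr i → sites p v s ≠ v i := fun i s hs he => by
    obtain ⟨a, ha⟩ := exists_inner_sites_lt hn hdim hv hp i
    exact (ha s hs).ne (by rw [he])
  rintro (j | i) (j' | i') h
  · exact congrArg _ (hpinj h)
  · exact absurd h (key i' _ (by simp))
  · exact absurd h.symm (key i _ (by simp))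
  · by_contra hne
    exact key i' _ hne h

/-- Far out in a direction exposing `v i` the constants no longer matter. Hence positivity of the
vertex domains never restricts `h`. -/
lemma exists_strict_inr (hn : 0 < n)
    (hdim : (interior (convexHull ℝ (range v))).Nonempty)
    (hv : ∀ i, v i ∉ convexHull ℝ (v '' {i' | i' ≠ i}))
    (hp : ∀ j, p j ∈ interior (convexHull ℝ (range v))) (c : Fin k ⊕ Fin m → ℝ) (i : Fin m) :
    ∃ x, ∀ s, s ≠ Sum.inr i →
      inner ℝ x (sites p v s) + c s < inner ℝ x (sites p v (Sum.inr i)) + c (Sum.inr i) := by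
  obtain ⟨a, ha⟩ := exists_inner_sites_lt hn hdim hv hp i
  have : ∀ᶠ t : ℝ in atTop, ∀ s, s ≠ Sum.inr i → inner ℝ (t • a) (sites p v s) + c s <
      inner ℝ (t • a) (sites p v (Sum.inr i)) + c (Sum.inr i) := by
    refine eventually_all.2 fun s => ?_
    by_cases hs : s = Sum.inr i
    · exact Eventually.of_forall fun _ h => absurd hs h
    filter_upwards [eventually_gt_atTop
      ((c s - c (Sum.inr i)) / (inner ℝ a (v i) - inner ℝ a (sites p v s)))] with t ht _
    rw [div_lt_iff₀ (sub_pos.2 (ha s hs))] at ht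
    simp only [real_inner_smul_left]
    change _ < t * inner ℝ a (v i) + _
    linarith
  obtain ⟨t, ht⟩ := this.exists
  exact ⟨_, ht⟩

lemma admissible_eq [Nonempty (Fin m)] (hinj : Function.Injective (sites p v)) (g : Fin m → ℝ) :
    admissible p v g = {h | ∀ s, ∃ x, ∀ t, t ≠ s → inner ℝ x (sites p v t) + heights g h t <
      inner ℝ x (sites p v s) + heights g h s} := by
  ext h
  exact forall_congr' fun s => volume_maxCell_pos_iff hinj

lemma isOpen_admissible [Nonempty (Fin m)] (hinj : Function.Injective (sites p v))
    (g : Fin m → ℝ) : IsOpen (admissible p v g) := by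
  rw [admissible_eq hinj]
  simp only [ofPred_forall, ofPred_exists]
  exact isOpen_iInter_of_finite fun s => isOpen_iUnion fun x => isOpen_iInter_of_finite fun t =>
    isOpen_iInter_of_finite fun _ => isOpen_lt (continuous_const.add (continuous_heights g t))
      (continuous_const.add (continuous_heights g s))

/-- The strict inequalities are jointly affine in `(h, x)`, so witnesses may be averaged along with
the heights. -/
lemma convex_admissible [Nonempty (Fin m)] (hinj : Function.Injective (sites p v))
    (g : Fin m → ℝ) : Convex ℝ (admissible p v g) := by
  rw [admissible_eq hinj]
  refine convex_iff_forall_pos.2 fun h hh h' hh' a b ha hb hab s => ?_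
  obtain ⟨x, hx⟩ := hh s
  obtain ⟨x', hx'⟩ := hh' s
  refine ⟨a • x + b • x', fun t ht => ?_⟩
  have h1 := mul_lt_mul_of_pos_left (hx t ht) ha
  have h2 := mul_lt_mul_of_pos_left (hx' t ht) hb
  simp only [heights_combo g h h' hab, inner_add_left, real_inner_smul_left]
  linarith

end Sites

/-! ### Critical points of convex functions. -/

section CriticalPoints

variable {E : Type*} [NormedAddCommGroup E] [InnerProductSpace ℝ E] [CompleteSpace E]
  {S : Set E} {F : E → ℝ} {x y : E}

lemma ConvexOn.le_of_hasGradientAt_zero (hF : ConvexOn ℝ S F) (hx : x ∈ S) (hy : y ∈ S)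
    (h : HasGradientAt F 0 x) : F x ≤ F y := by
  have h1 : ConvexOn ℝ (AffineMap.lineMap x y ⁻¹' S) (F ∘ AffineMap.lineMap (k := ℝ) x y) :=
    hF.comp_affineMap _
  have h2 : HasDerivAt (F ∘ AffineMap.lineMap (k := ℝ) x y) 0 0 := by
    have h3 : HasFDerivAt F (0 : E →L[ℝ] ℝ) (AffineMap.lineMap (k := ℝ) x y (0 : ℝ)) := by
      simpa [hasGradientAt_iff_hasFDerivAt] using h
    simpa using h3.comp_hasDerivAt (0 : ℝ) AffineMap.hasDerivAt_lineMap
  have h3 := h1.le_slope_of_hasDerivAt (x := 0) (y := 1) (by simpa) (by simpa) one_pos h2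
  simpa [slope_def_field] using h3

lemma StrictConvexOn.eq_of_hasGradientAt_zero (hF : StrictConvexOn ℝ S F) (hx : x ∈ S)
    (hy : y ∈ S) (h : HasGradientAt F 0 x) (h' : HasGradientAt F 0 y) : x = y := by
  refine hF.eq_of_isMinOn (fun z hz => ?_) (fun z hz => ?_) hx hy
  · exact ConvexOn.le_of_hasGradientAt_zero hF.convexOn hx hz h
  · exact ConvexOn.le_of_hasGradientAt_zero hF.convexOn hy hz h'

end CriticalPoints

lemma integrable_sum_indicator_const {α κ G : Type*} [MeasurableSpace α] {μ : Measure α}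
    [Fintype κ] [NormedAddCommGroup G] [NormedSpace ℝ G] [CompleteSpace G] {S : κ → Set α}
    (hS : ∀ j, MeasurableSet (S j)) (hμ : ∀ j, μ (S j) ≠ ∞) (P : κ → G) :
    Integrable (fun x => ∑ j, (S j).indicator (fun _ => P j) x) μ ∧
      ∫ x, ∑ j, (S j).indicator (fun _ => P j) x ∂μ = ∑ j, (μ (S j)).toReal • P j := by
  have hint : ∀ j, Integrable ((S j).indicator fun _ => P j) μ := fun j =>
    (integrable_indicator_iff (hS j)).2 (integrableOn_const (hμ j) enorm_ne_top)
  refine ⟨integrable_finsetSum _ fun j _ => hint j, ?_⟩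
  rw [integral_finsetSum _ fun j _ => hint j]
  exact Finset.sum_congr rfl fun j _ => integral_indicator_const _ (hS j)

/-! ### The energy: gradient, strict convexity, coercivity. -/

section Energy

variable {n k m : ℕ} {v : Fin m → EuclideanSpace ℝ (Fin n)} {p : Fin k → EuclideanSpace ℝ (Fin n)}
  {g : Fin m → ℝ} {h h' : EuclideanSpace ℝ (Fin k)} {x : EuclideanSpace ℝ (Fin n)}

/-- The amount by which the terms with slopes `p_j` lift the maximum of the others. -/
noncomputable def excess (p : Fin k → EuclideanSpace ℝ (Fin n))
    (v : Fin m → EuclideanSpace ℝ (Fin n)) (g : Fin m → ℝ) (h : EuclideanSpace ℝ (Fin k))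
    (x : EuclideanSpace ℝ (Fin n)) : ℝ :=
  plMax (sites p v) (heights g h) x - plMax v (fun i => -g i) x

/-- The functional whose critical point solves the Dirichlet problem. -/
noncomputable def energy (p : Fin k → EuclideanSpace ℝ (Fin n))
    (v : Fin m → EuclideanSpace ℝ (Fin n)) (g : Fin m → ℝ) (A : Fin k → ℝ)
    (h : EuclideanSpace ℝ (Fin k)) : ℝ :=
  (∫ x, excess p v g h x) - ∑ j, A j * h j

lemma le_excess (j : Fin k) :
    inner ℝ x (p j) + h j - plMax v (fun i => -g i) x ≤ excess p v g h x :=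
  sub_le_sub_right (le_plMax (sites p v) (heights g h) x (Sum.inl j)) _

lemma heights_sub_le (g : Fin m → ℝ) (h h' : EuclideanSpace ℝ (Fin k)) (s : Fin k ⊕ Fin m) :
    heights g h s ≤ heights g h' s + ‖h - h'‖ := by
  cases s with
  | inl j =>
    have := (le_abs_self _).trans (PiLp.norm_apply_le (h - h') j)
    simp only [PiLp.sub_apply] at this
    simp only [heights, Sum.elim_inl]
    linarith
  | inr i =>
    simp only [heights, Sum.elim_inr]
    linarith [norm_nonneg (h - h')]

variable [Nonempty (Fin m)]

lemma continuous_excess (p : Fin k → EuclideanSpace ℝ (Fin n))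
    (v : Fin m → EuclideanSpace ℝ (Fin n)) (g : Fin m → ℝ) (h : EuclideanSpace ℝ (Fin k)) :
    Continuous (excess p v g h) :=
  (continuous_plMax _ _).sub (continuous_plMax _ _)

lemma excess_nonneg : 0 ≤ excess p v g h x :=
  sub_nonneg.2 <| plMax_le fun i => le_plMax (sites p v) (heights g h) x (Sum.inr i)

lemma excess_eq_zero (hx : ∀ j, inner ℝ x (p j) + h j ≤ plMax v (fun i => -g i) x) :
    excess p v g h x = 0 := by
  refine le_antisymm (sub_nonpos.2 <| plMax_le ?_) excess_nonneg
  rintro (j | i)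
  · exact hx j
  · exact le_plMax v (fun i => -g i) x i

lemma excess_le_add_norm : excess p v g h x ≤ excess p v g h' x + ‖h - h'‖ := by
  have : plMax (sites p v) (heights g h) x ≤ plMax (sites p v) (heights g h') x + ‖h - h'‖ := by
    refine plMax_le fun s => ?_
    have h1 := le_plMax (sites p v) (heights g h') x s
    have h2 := heights_sub_le g h h' s
    linarith
  unfold excess
  linarith

lemma abs_excess_sub_le : |excess p v g h x - excess p v g h' x| ≤ ‖h - h'‖ := by
  have h1 := excess_le_add_norm (p := p) (v := v) (g := g) (h := h) (h' := h') (x := x)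
  have h2 := excess_le_add_norm (p := p) (v := v) (g := g) (h := h') (h' := h) (x := x)
  rw [norm_sub_rev] at h2
  exact abs_le.2 ⟨by linarith, by linarith⟩

lemma excess_combo_le {a b : ℝ} (ha : 0 ≤ a) (hb : 0 ≤ b) (hab : a + b = 1) :
    excess p v g (a • h + b • h') x ≤ a * excess p v g h x + b * excess p v g h' x := by
  have : plMax (sites p v) (heights g (a • h + b • h')) x ≤
      a * plMax (sites p v) (heights g h) x + b * plMax (sites p v) (heights g h') x := by
    refine plMax_le fun s => ?_
    have h1 := mul_le_mul_of_nonneg_left (le_plMax (sites p v) (heights g h) x s) ha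
    have h2 := mul_le_mul_of_nonneg_left (le_plMax (sites p v) (heights g h') x s) hb
    rw [heights_combo g h h' hab]
    have e : inner ℝ x (sites p v s) = a * inner ℝ x (sites p v s) + b * inner ℝ x (sites p v s) :=
      by rw [← add_mul, hab, one_mul]
    linarith
  unfold excess
  have e : plMax v (fun i => -g i) x =
      a * plMax v (fun i => -g i) x + b * plMax v (fun i => -g i) x := by
    rw [← add_mul, hab, one_mul]
  linarith

lemma exists_coercive_uniform (hp : ∀ j, p j ∈ interior (convexHull ℝ (range v)))
    (g : Fin m → ℝ) :
    ∃ r B : ℝ, 0 < r ∧ ∀ j x, inner ℝ x (p j) + r * ‖x‖ ≤ plMax v (fun i => -g i) x + B := by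
  choose r hr h using fun j => exists_coercive (hp j)
  obtain ⟨i, hi⟩ := Finite.exists_max g
  have : ∀ᶠ ρ in 𝓝[>] (0 : ℝ), ∀ j, ρ < r j :=
    eventually_all.2 fun j => nhdsWithin_le_nhds (eventually_lt_nhds (hr j))
  obtain ⟨ρ, h1, h2⟩ := (this.and self_mem_nhdsWithin).exists
  refine ⟨ρ, g i, h2, fun j x => ?_⟩
  have h3 := h j (fun i => -g i) (g i) (fun i' => by simpa using hi i') x
  have := mul_le_mul_of_nonneg_right (h1 j).le (norm_nonneg x)
  linarith

/-- Locally uniformly in `h`, the excess is supported in a fixed ball. -/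
lemma exists_excess_eq_zero (hp : ∀ j, p j ∈ interior (convexHull ℝ (range v)))
    (g : Fin m → ℝ) (M : ℝ) :
    ∃ R, ∀ h : EuclideanSpace ℝ (Fin k), ‖h‖ ≤ M → ∀ x, R < ‖x‖ → excess p v g h x = 0 := by
  obtain ⟨r, B, hr, hB⟩ := exists_coercive_uniform hp g
  refine ⟨(B + M) / r, fun h hh x hx => excess_eq_zero fun j => ?_⟩
  rw [div_lt_iff₀ hr] at hx
  have h1 := (le_abs_self _).trans (PiLp.norm_apply_le h j)
  linarith [hB j x]

lemma integrable_excess (hp : ∀ j, p j ∈ interior (convexHull ℝ (range v)))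
    (g : Fin m → ℝ) (h : EuclideanSpace ℝ (Fin k)) : Integrable (excess p v g h) := by
  obtain ⟨R, hR⟩ := exists_excess_eq_zero hp g ‖h‖
  refine (continuous_excess p v g h).integrable_of_hasCompactSupport ?_
  refine HasCompactSupport.intro (isCompact_closedBall 0 R) fun x hx => hR h le_rfl x ?_
  simpa using hx

lemma isBounded_maxCell_inl (hp : ∀ j, p j ∈ interior (convexHull ℝ (range v)))
    (c : Fin k ⊕ Fin m → ℝ) (j : Fin k) : Bornology.IsBounded (maxCell (sites p v) c (Sum.inl j)) :=
  isBounded_maxCell c (by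
    rw [convexHull_range_sites fun j => interior_subset (hp j)]
    exact hp j)

/-- Inside the domain of `s`, term `s` stays strictly largest for heights near `h`, so the excess is
locally affine in the height. At most one indicator in the sum is nonzero. -/
lemma hasFDerivAt_excess (hinj : Function.Injective (sites p v)) {s : Fin k ⊕ Fin m}
    (hx : x ∈ interior (maxCell (sites p v) (heights g h) s)) :
    HasFDerivAt (fun h => excess p v g h x)
      (∑ j, (maxCell (sites p v) (heights g h) (Sum.inl j)).indicator
        (fun _ => (EuclideanSpace.proj j : EuclideanSpace ℝ (Fin k) →L[ℝ] ℝ)) x) h := by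
  have hstr := strict_of_mem_interior_maxCell hinj hx
  have hev : ∀ᶠ h' in 𝓝 h, excess p v g h' x =
      inner ℝ x (sites p v s) + heights g h' s - plMax v (fun i => -g i) x := by
    have : ∀ᶠ h' in 𝓝 h, ∀ t, t ≠ s → inner ℝ x (sites p v t) + heights g h' t <
        inner ℝ x (sites p v s) + heights g h' s := by
      refine eventually_all.2 fun t => ?_
      by_cases ht : t = s
      · exact Eventually.of_forall fun _ h => absurd ht h
      · filter_upwards [(continuous_const.add (continuous_heights g t)).continuousAt.eventually_lt
          (continuous_const.add (continuous_heights g s)).continuousAt (hstr t ht)] with h' hh' _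
        exact hh'
    filter_upwards [this] with h' hh'
    have : x ∈ maxCell (sites p v) (heights g h') s := fun t => by
      rcases eq_or_ne t s with rfl | ht
      · exact le_rfl
      · exact (hh' t ht).le
    rw [excess, mem_maxCell_iff.1 this]
  have hnot : ∀ t, t ≠ s → x ∉ maxCell (sites p v) (heights g h) t := fun t ht hxt =>
    (hstr t ht).not_ge (hxt s)
  refine HasFDerivAt.congr_of_eventuallyEq ?_ hev
  refine HasFDerivAt.sub_const _ (HasFDerivAt.const_add _ ?_)
  cases s with
  | inl j =>
    rw [Finset.sum_eq_single j, indicator_of_mem (interior_subset hx)]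
    · exact (EuclideanSpace.proj j : EuclideanSpace ℝ (Fin k) →L[ℝ] ℝ).hasFDerivAt
    · intro j' _ hj'
      exact indicator_of_notMem (hnot _ fun he => hj' (Sum.inl_injective he)) _
    · simp
  | inr i =>
    rw [Finset.sum_eq_zero]
    · exact hasFDerivAt_const (-g i) h
    · intro j _
      exact indicator_of_notMem (hnot _ (by simp)) _

lemma hasFDerivAt_integral_excess (hinj : Function.Injective (sites p v))
    (hp : ∀ j, p j ∈ interior (convexHull ℝ (range v))) (g : Fin m → ℝ)
    (h : EuclideanSpace ℝ (Fin k)) :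
    HasFDerivAt (fun h => ∫ x, excess p v g h x)
      (∑ j, (volume (maxCell (sites p v) (heights g h) (Sum.inl j))).toReal •
        (EuclideanSpace.proj j : EuclideanSpace ℝ (Fin k) →L[ℝ] ℝ)) h := by
  -- With margin 1, a single ball of radius `R` carries the excess for every height in the unit ball
  -- around `h`; its indicator is the integrable Lipschitz bound.
  obtain ⟨R, hR⟩ := exists_excess_eq_zero hp g (‖h‖ + 1)
  obtain ⟨hsum, heq⟩ := integrable_sum_indicator_const (μ := volume)
    (S := fun j => maxCell (sites p v) (heights g h) (Sum.inl j))
    (fun j => (isClosed_maxCell _ _ _).measurableSet)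
    (fun j => (isBounded_maxCell_inl hp _ j).measure_lt_top.ne)
    (fun j => (EuclideanSpace.proj j : EuclideanSpace ℝ (Fin k) →L[ℝ] ℝ))
  rw [← heq]
  refine (hasFDerivAt_integral_of_dominated_loc_of_lip' (μ := volume)
    (F := fun h x => excess p v g h x) (s := Metric.ball h 1)
    (bound := (Metric.closedBall 0 R).indicator fun _ => 1)
    (Metric.ball_mem_nhds h one_pos)
    (fun h' _ => (continuous_excess p v g h').aestronglyMeasurable) (integrable_excess hp g h)
    hsum.aestronglyMeasurable ?_ ?_ ?_).2
  · refine Eventually.of_forall fun x h' hh' => ?_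
    by_cases hx : ‖x‖ ≤ R
    · rw [indicator_of_mem (by simpa using hx), one_mul]
      exact abs_excess_sub_le
    · rw [mem_ball_iff_norm] at hh'
      have h1 : ‖h'‖ ≤ ‖h‖ + 1 := by
        have := norm_le_norm_add_norm_sub' h' h
        linarith
      rw [hR h' h1 x (not_le.1 hx), hR h (by linarith) x (not_le.1 hx),
        indicator_of_notMem (by simpa using hx)]
      simp
  · exact (integrable_indicator_iff Metric.isClosed_closedBall.measurableSet).2
      (integrableOn_const measure_closedBall_lt_top.ne enorm_ne_top)
  · filter_upwards [ae_mem_interior_maxCell (sites p v) (heights g h)] with x ⟨s, hs⟩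
    exact hasFDerivAt_excess hinj hs

theorem hasGradientAt_energy (hinj : Function.Injective (sites p v))
    (hp : ∀ j, p j ∈ interior (convexHull ℝ (range v))) (g : Fin m → ℝ) (A : Fin k → ℝ)
    (h : EuclideanSpace ℝ (Fin k)) :
    HasGradientAt (energy p v g A) (WithLp.toLp 2 fun j =>
      (volume (maxCell (sites p v) (heights g h) (Sum.inl j))).toReal - A j) h := by
  have hlin : HasFDerivAt (fun h : EuclideanSpace ℝ (Fin k) => ∑ j, A j * h j)
      (∑ j, A j • (EuclideanSpace.proj j : EuclideanSpace ℝ (Fin k) →L[ℝ] ℝ)) h :=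
    HasFDerivAt.fun_sum fun j _ =>
      (EuclideanSpace.proj j : EuclideanSpace ℝ (Fin k) →L[ℝ] ℝ).hasFDerivAt.const_mul (A j)
  rw [hasGradientAt_iff_hasFDerivAt]
  have heq : InnerProductSpace.toDual ℝ (EuclideanSpace ℝ (Fin k)) (WithLp.toLp 2 fun j =>
        (volume (maxCell (sites p v) (heights g h) (Sum.inl j))).toReal - A j) =
      (∑ j, (volume (maxCell (sites p v) (heights g h) (Sum.inl j))).toReal •
        (EuclideanSpace.proj j : EuclideanSpace ℝ (Fin k) →L[ℝ] ℝ)) -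
      ∑ j, A j • (EuclideanSpace.proj j : EuclideanSpace ℝ (Fin k) →L[ℝ] ℝ) := by
    rw [← Finset.sum_sub_distrib]
    ext z
    simp only [InnerProductSpace.toDual_apply_apply, PiLp.inner_apply,
      sum_apply, ← sub_smul, smul_apply,
      PiLp.proj_apply, smul_eq_mul]
    exact Finset.sum_congr rfl fun j _ => mul_comm _ _
  rw [heq]
  exact (hasFDerivAt_integral_excess hinj hp g h).sub hlin

/-- Equality forces the term that is largest for the averaged heights to be largest for both `h` and
`h'`. The difference of the two excesses is then constant on each domain, so it is continuous with
finite range, hence constant. It vanishes on a vertex domain, and on the domain of `p j` it equals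
`h j - h' j`. -/
lemma eq_of_excess_combo_eq {a b : ℝ} (ha : 0 < a) (hb : 0 < b) (hab : a + b = 1)
    (hne : ∀ s, (maxCell (sites p v) (heights g (a • h + b • h')) s).Nonempty)
    (heq : ∀ x, excess p v g (a • h + b • h') x =
      a * excess p v g h x + b * excess p v g h' x) : h = h' := by
  have hdiff : ∀ s x, x ∈ maxCell (sites p v) (heights g (a • h + b • h')) s →
      excess p v g h x - excess p v g h' x = heights g h s - heights g h' s := by
    intro s x hx
    have h0 := heq x
    have h1 := le_plMax (sites p v) (heights g h) x s
    have h2 := le_plMax (sites p v) (heights g h') x s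
    unfold excess at h0 ⊢
    rw [mem_maxCell_iff.1 hx, heights_combo g h h' hab] at h0
    have e : ∀ t : ℝ, a * t + b * t = t := fun t => by rw [← add_mul, hab, one_mul]
    have e1 := e (inner ℝ x (sites p v s))
    have e2 := e (plMax v (fun i => -g i) x)
    have h3 := mul_le_mul_of_nonneg_left h1 ha.le
    have h4 := mul_le_mul_of_nonneg_left h2 hb.le
    have h5 := mul_left_cancel₀ ha.ne' (le_antisymm h3 (by linarith))
    have h6 := mul_left_cancel₀ hb.ne' (le_antisymm h4 (by linarith))
    linarith
  have hfin : (range fun x => excess p v g h x - excess p v g h' x).Finite := by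
    refine (finite_range fun s => heights g h s - heights g h' s).subset ?_
    rintro _ ⟨x, rfl⟩
    obtain ⟨s, hs⟩ := exists_mem_maxCell (sites p v) (heights g (a • h + b • h')) x
    exact ⟨s, (hdiff s x hs).symm⟩
  have hsub : (range fun x => excess p v g h x - excess p v g h' x).Subsingleton := by
    by_contra hns
    exact (isPreconnected_range ((continuous_excess p v g h).sub
      (continuous_excess p v g h'))).infinite_of_nontrivial (not_subsingleton_iff.1 hns) hfin
  have i : Fin m := Classical.arbitrary _
  obtain ⟨x₀, hx₀⟩ := hne (Sum.inr i)
  ext j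
  obtain ⟨x, hx⟩ := hne (Sum.inl j)
  have h1 := hsub ⟨x, rfl⟩ ⟨x₀, rfl⟩
  simp only [hdiff _ _ hx, hdiff _ _ hx₀, heights, Sum.elim_inl, Sum.elim_inr] at h1
  linarith

theorem strictConvexOn_energy (hinj : Function.Injective (sites p v))
    (hp : ∀ j, p j ∈ interior (convexHull ℝ (range v))) (g : Fin m → ℝ) (A : Fin k → ℝ) :
    StrictConvexOn ℝ (admissible p v g) (energy p v g A) := by
  refine ⟨convex_admissible hinj g, fun h hh h' hh' hne a b ha hb hab => ?_⟩
  have hmid := convex_admissible hinj g hh hh' ha.le hb.le hab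
  set D := fun x => a * excess p v g h x + b * excess p v g h' x -
    excess p v g (a • h + b • h') x with hD
  have hDnn : 0 ≤ D := fun x => sub_nonneg.2 (excess_combo_le ha.le hb.le hab)
  have hDi : Integrable D :=
    (((integrable_excess hp g h).const_mul a).add ((integrable_excess hp g h').const_mul b)).sub
      (integrable_excess hp g _)
  have hDc : Continuous D :=
    ((continuous_const.mul (continuous_excess p v g h)).add
      (continuous_const.mul (continuous_excess p v g h'))).sub (continuous_excess p v g _)
  have hDint : ∫ x, D x = a * (∫ x, excess p v g h x) + b * (∫ x, excess p v g h' x) -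
      ∫ x, excess p v g (a • h + b • h') x := by
    rw [← integral_const_mul, ← integral_const_mul,
      ← integral_add ((integrable_excess hp g h).const_mul a)
        ((integrable_excess hp g h').const_mul b)]
    exact integral_sub (((integrable_excess hp g h).const_mul a).add
      ((integrable_excess hp g h').const_mul b)) (integrable_excess hp g _)
  -- A continuous nonnegative convexity defect with zero integral vanishes everywhere, not just
  -- almost everywhere.
  have hpos : 0 < ∫ x, D x := by
    refine (integral_nonneg hDnn).lt_of_ne fun h0 => hne ?_
    have h1 := (hDc.ae_eq_iff_eq volume continuous_zero).1
      ((integral_eq_zero_iff_of_nonneg hDnn hDi).1 h0.symm)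
    refine eq_of_excess_combo_eq ha hb hab
      (fun s => nonempty_of_measure_ne_zero (hmid s).ne') fun x => ?_
    have := congrFun h1 x
    simp only [hD, Pi.zero_apply] at this
    linarith
  have hlin : ∑ j, A j * (a • h + b • h') j = a * ∑ j, A j * h j + b * ∑ j, A j * h' j := by
    rw [Finset.mul_sum, Finset.mul_sum, ← Finset.sum_add_distrib]
    refine Finset.sum_congr rfl fun j _ => ?_
    simp only [PiLp.add_apply, PiLp.smul_apply, smul_eq_mul]
    ring
  simp only [energy, smul_eq_mul, hlin]
  linarith

lemma exists_ball_volume_ge (hn : 0 < n) (K : ℝ) :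
    ∃ R, K ≤ (volume (Metric.ball (0 : EuclideanSpace ℝ (Fin n)) R)).toReal := by
  have : Nonempty (Fin n) := ⟨⟨0, hn⟩⟩
  set μ := (volume (Metric.ball (0 : EuclideanSpace ℝ (Fin n)) 1)).toReal with hμ
  have hpos : 0 < μ := ENNReal.toReal_pos (Metric.measure_ball_pos _ _ one_pos).ne'
    measure_ball_lt_top.ne
  set r := max 1 (K / μ) with hr
  have hr1 : 1 ≤ r := le_max_left _ _
  refine ⟨r, ?_⟩
  rw [Measure.addHaar_ball _ _ (by linarith), ENNReal.toReal_mul,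
    ENNReal.toReal_ofReal (by positivity), finrank_euclideanSpace_fin]
  calc K = K / μ * μ := by field_simp
    _ ≤ r ^ n * μ := mul_le_mul_of_nonneg_right
      ((le_max_right _ _).trans (le_self_pow₀ hr1 hn.ne')) hpos.le

/-- On a ball of volume at least `K` the excess is at least `h j` minus a constant, so the integral
grows in `h j` with any prescribed slope. -/
lemma exists_mul_le_integral_excess (hn : 0 < n)
    (hp : ∀ j, p j ∈ interior (convexHull ℝ (range v))) (g : Fin m → ℝ) {K : ℝ} (hK : 0 ≤ K) :
    ∃ C, 0 ≤ C ∧ ∀ (h : EuclideanSpace ℝ (Fin k)) (j : Fin k),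
      K * h j ≤ (∫ x, excess p v g h x) + C := by
  obtain ⟨R, hR⟩ := exists_ball_volume_ge hn K
  set V := (volume (Metric.ball (0 : EuclideanSpace ℝ (Fin n)) R)).toReal with hV
  have hbd : ∀ j, ∃ c, ∀ x ∈ Metric.ball (0 : EuclideanSpace ℝ (Fin n)) R,
      plMax v (fun i => -g i) x - inner ℝ x (p j) ≤ c := fun j => by
    obtain ⟨c, hc⟩ := (isCompact_closedBall (0 : EuclideanSpace ℝ (Fin n)) R).bddAbove_image
      (((continuous_plMax v fun i => -g i).sub
        (continuous_id.inner continuous_const : Continuous fun x => inner ℝ x (p j))).continuousOn)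
    exact ⟨c, fun x hx => hc (mem_image_of_mem _ (Metric.ball_subset_closedBall hx))⟩
  choose c hc using hbd
  have hcsum : ∀ j, c j ≤ ∑ j, |c j| := fun j =>
    (le_abs_self _).trans (Finset.single_le_sum (fun j _ => abs_nonneg (c j)) (Finset.mem_univ j))
  refine ⟨V * ∑ j, |c j|, by positivity, fun h j => ?_⟩
  have h0 : 0 ≤ ∫ x, excess p v g h x := integral_nonneg fun _ => excess_nonneg
  have hC : 0 ≤ V * ∑ j, |c j| := by positivity
  rcases le_total (h j) 0 with hj | hj
  · have := mul_nonpos_of_nonneg_of_nonpos hK hj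
    linarith
  · have h1 : V * (h j - ∑ j, |c j|) ≤ ∫ x, excess p v g h x :=
      calc V * (h j - ∑ j, |c j|)
          = ∫ x in Metric.ball (0 : EuclideanSpace ℝ (Fin n)) R, (h j - ∑ j, |c j|) := by
            rw [setIntegral_const, smul_eq_mul, measureReal_def]
        _ ≤ ∫ x in Metric.ball (0 : EuclideanSpace ℝ (Fin n)) R, excess p v g h x := by
            refine setIntegral_mono_on (integrableOn_const measure_ball_lt_top.ne)
              (integrable_excess hp g h).integrableOn measurableSet_ball fun x hx => ?_
            have h1 := le_excess (p := p) (v := v) (g := g) (h := h) (x := x) j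
            have h2 := hc j x hx
            have h3 := hcsum j
            linarith
        _ ≤ ∫ x, excess p v g h x := setIntegral_le_integral (integrable_excess hp g h)
            (Eventually.of_forall fun _ => excess_nonneg)
    have := mul_le_mul_of_nonneg_right hR hj
    linarith

lemma exists_energy_lower_bound (hn : 0 < n)
    (hp : ∀ j, p j ∈ interior (convexHull ℝ (range v))) (g : Fin m → ℝ) {A : Fin k → ℝ}
    (hA : ∀ j, 0 < A j) :
    ∃ C, ∀ h : EuclideanSpace ℝ (Fin k), ∑ j, min 1 (A j) * |h j| ≤ energy p v g A h + C := by
  have hS : ∀ j, A j + 1 ≤ ∑ j, (A j + 1) := fun j =>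
    Finset.single_le_sum (f := fun j => A j + 1) (fun j _ => by linarith [hA j])
      (Finset.mem_univ j)
  have hS0 : 0 ≤ ∑ j, (A j + 1) := Finset.sum_nonneg fun j _ => by linarith [hA j]
  -- The factor `k` lets each coordinate use a `1 / k` share of the integral; the sum dominates
  -- every `A j + 1`, which absorbs the linear term and leaves slope 1.
  obtain ⟨C, hC0, hC⟩ := exists_mul_le_integral_excess hn hp g
    (mul_nonneg (Nat.cast_nonneg (α := ℝ) k) hS0)
  refine ⟨C, fun h => ?_⟩
  have h0 : 0 ≤ ∫ x, excess p v g h x := integral_nonneg fun _ => excess_nonneg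
  set I := ∫ x, excess p v g h x with hI
  have hj : ∀ j, min 1 (A j) * |h j| + A j * h j ≤ (I + C) / k := by
    intro j
    have hk : (0 : ℝ) < k := Nat.cast_pos.2 (Fin.pos j)
    rw [le_div_iff₀ hk]
    rcases le_total 0 (h j) with hh | hh
    · have h1 := hC h j
      rw [abs_of_nonneg hh]
      have h2 : min 1 (A j) * h j ≤ 1 * h j := mul_le_mul_of_nonneg_right (min_le_left _ _) hh
      have h3 := mul_le_mul_of_nonneg_right (hS j) hh
      have h4 := mul_le_mul_of_nonneg_left
        (show min 1 (A j) * h j + A j * h j ≤ (∑ j, (A j + 1)) * h j by linarith) hk.le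
      linarith
    · rw [abs_of_nonpos hh]
      have h2 : min 1 (A j) * -h j ≤ A j * -h j :=
        mul_le_mul_of_nonneg_right (min_le_right _ _) (neg_nonneg.2 hh)
      have h3 : (min 1 (A j) * -h j + A j * h j) * k ≤ 0 :=
        mul_nonpos_of_nonpos_of_nonneg (by linarith) hk.le
      linarith
  have hsum := Finset.sum_le_sum fun j (_ : j ∈ Finset.univ) => hj j
  rw [Finset.sum_add_distrib, Finset.sum_const, Finset.card_univ, Fintype.card_fin,
    nsmul_eq_mul] at hsum
  have hle : (k : ℝ) * ((I + C) / k) ≤ I + C := by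
    -- For `k = 0` the quotient is 0 by convention, and `I + C ≥ 0` is what remains.
    rcases Nat.eq_zero_or_pos k with rfl | hk
    · simp
      linarith
    · rw [mul_div_cancel₀ _ (Nat.cast_pos.2 hk).ne']
  rw [energy]
  linarith

lemma exists_isMinOn_energy (hn : 0 < n) (hinj : Function.Injective (sites p v))
    (hp : ∀ j, p j ∈ interior (convexHull ℝ (range v))) (g : Fin m → ℝ) {A : Fin k → ℝ}
    (hA : ∀ j, 0 < A j) :
    ∃ h, ∀ h', energy p v g A h ≤ energy p v g A h' := by
  obtain ⟨C, hC⟩ := exists_energy_lower_bound hn hp g hA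
  have hcont : Continuous (energy p v g A) := continuous_iff_continuousAt.2 fun h =>
    (hasGradientAt_energy hinj hp g A h).continuousAt
  refine hcont.exists_forall_le ?_
  obtain ⟨δ, hδ, hδ0⟩ : ∃ δ : ℝ, (∀ j, δ < min 1 (A j)) ∧ 0 < δ := by
    have : ∀ᶠ δ in 𝓝[>] (0 : ℝ), ∀ j, δ < min 1 (A j) := eventually_all.2 fun j =>
      nhdsWithin_le_nhds (eventually_lt_nhds (lt_min one_pos (hA j)))
    exact (this.and self_mem_nhdsWithin).exists
  have hlim : Tendsto (fun h : EuclideanSpace ℝ (Fin k) => δ * ‖h‖ - C) (cocompact _) atTop :=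
    tendsto_atTop_add_const_right _ _ (tendsto_norm_cocompact_atTop.const_mul_atTop hδ0)
  refine tendsto_atTop_mono (fun h => ?_) hlim
  have hnorm : ‖h‖ ≤ ∑ j, |h j| := by
    conv_lhs => rw [← (EuclideanSpace.basisFun (Fin k) ℝ).sum_repr h]
    refine (norm_sum_le _ _).trans (Finset.sum_le_sum fun j _ => ?_)
    rw [norm_smul]
    simp
  have h1 : δ * ‖h‖ ≤ ∑ j, min 1 (A j) * |h j| := by
    refine (mul_le_mul_of_nonneg_left hnorm hδ0.le).trans ?_
    rw [Finset.mul_sum]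
    exact Finset.sum_le_sum fun j _ => mul_le_mul_of_nonneg_right (hδ j).le (abs_nonneg _)
  linarith [hC h]

end Energy

end DMAE

/-! ### The Dirichlet problem. -/

open DMAE in
theorem theorem1p3 {n k m : ℕ} (hn : 0 < n)
    (v : Fin m → EuclideanSpace ℝ (Fin n)) (p : Fin k → EuclideanSpace ℝ (Fin n))
    (hdim : (interior (convexHull ℝ (Set.range v))).Nonempty)
    (hv : ∀ i, v i ∉ convexHull ℝ (v '' {i' | i' ≠ i}))
    (hp : ∀ j, p j ∈ interior (convexHull ℝ (Set.range v)))
    (hpinj : Function.Injective p)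
    (g : Fin m → ℝ) (A : Fin k → ℝ) (hA : ∀ j, 0 < A j) :
    ∃ (T : Set (Set (EuclideanSpace ℝ (Fin n)))) (w : EuclideanSpace ℝ (Fin n) → ℝ)
      (h : EuclideanSpace ℝ (Fin k)) (F : EuclideanSpace ℝ (Fin k) → ℝ),
      -- the decomposition and the solution of the Dirichlet problem
      IsConvexSubdivision (convexHull ℝ (Set.range v)) T ∧
      vertices T = Set.range v ∪ Set.range p ∧
      IsPLConvexOn (convexHull ℝ (Set.range v)) T w ∧
      (∀ i, w (v i) = g i) ∧
      (∀ j, discreteHessianDet T w (p j) = ENNReal.ofReal (A j)) ∧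
      -- `w` is the Legendre dual, whose domain is the polytope
      (∀ y ∈ convexHull ℝ (Set.range v),
        legendreDual (fun x => (plMax (sites p v) (heights g h) x : EReal)) y = (w y : EReal)) ∧
      (∀ y ∉ convexHull ℝ (Set.range v),
        legendreDual (fun x => (plMax (sites p v) (heights g h) x : EReal)) y = ⊤) ∧
      -- `F` is strictly convex on the open convex set `H`, with gradient `vol (W_j) - A_j`
      IsOpen (admissible p v g) ∧
      StrictConvexOn ℝ (admissible p v g) F ∧
      (∀ h' ∈ admissible p v g, HasGradientAt F
        (WithLp.toLp 2 fun j =>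
          (volume (maxCell (sites p v) (heights g h') (Sum.inl j))).toReal - A j) h') ∧
      -- `h` is its unique critical point
      (∀ h', h' ∈ admissible p v g ∧ HasGradientAt F 0 h' ↔ h' = h) := by
  have hne : Nonempty (Fin m) := by
    obtain ⟨y, hy⟩ := hdim
    obtain ⟨_, i, -⟩ := convexHull_nonempty_iff.1 ⟨y, interior_subset hy⟩
    exact ⟨i⟩
  have hinj := injective_sites hn hdim hv hp hpinj
  have hhull : convexHull ℝ (range (sites p v)) = convexHull ℝ (range v) :=
    convexHull_range_sites fun j => interior_subset (hp j)
  obtain ⟨h, hmin⟩ := exists_isMinOn_energy hn hinj hp g hA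
  have hgrad := hasGradientAt_energy hinj hp g A h
  have hcrit : HasGradientAt (energy p v g A) 0 h := by
    have h0 := IsLocalMin.hasFDerivAt_eq_zero (Filter.Eventually.of_forall hmin) hgrad.hasFDerivAt
    rw [hasGradientAt_iff_hasFDerivAt, map_zero, ← h0]
    exact hgrad.hasFDerivAt
  have hvol : ∀ j, volume (maxCell (sites p v) (heights g h) (Sum.inl j)) =
      ENNReal.ofReal (A j) := fun j => by
    have h1 := congrArg (fun z : EuclideanSpace ℝ (Fin k) => z j) (hgrad.unique hcrit)
    simp only [PiLp.zero_apply, sub_eq_zero] at h1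
    rw [← h1, ENNReal.ofReal_toReal (isBounded_maxCell_inl hp _ j).measure_lt_top.ne]
  -- The minimum was taken over all heights; the critical equations themselves place `h` in `H`,
  -- because `A j > 0`.
  have hadm : h ∈ admissible p v g := by
    rintro (j | i)
    · rw [hvol j, ENNReal.ofReal_pos]
      exact hA j
    · exact (volume_maxCell_pos_iff hinj).2 (exists_strict_inr hn hdim hv hp _ i)
  have hcell : ∀ s, (maxCell (sites p v) (heights g h) s).Nonempty := fun s =>
    nonempty_of_measure_ne_zero (hadm s).ne'
  refine ⟨dualSubdivision (sites p v) (heights g h), realDual (sites p v) (heights g h), h,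
    energy p v g A, ?_, ?_, ?_, fun i => ?_, fun j => ?_, fun y hy => ?_, fun y hy => ?_,
    isOpen_admissible hinj g, strictConvexOn_energy hinj hp g A,
    fun h' _ => hasGradientAt_energy hinj hp g A h', fun h' => ⟨?_, ?_⟩⟩
  · rw [← hhull] at hdim ⊢
    exact isConvexSubdivision_dualSubdivision _ hdim
  · rw [vertices_dualSubdivision fun s => (volume_maxCell_pos_iff hinj).1 (hadm s), sites,
      Sum.elim_range, union_comm]
  · rw [← hhull]
    exact isPLConvexOn_realDual _ _
  · simpa [heights, sites] using realDual_apply_eq_neg (hcell (Sum.inr i))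
  · rw [← hvol j, ← discreteHessianDet_dualSubdivision (by rw [hhull]; exact hp j) (hcell _)]
    rfl
  · exact legendreDual_eq_realDual (hhull ▸ hy)
  · exact legendreDual_eq_top (hhull ▸ hy)
  · rintro ⟨h1, h2⟩
    exact StrictConvexOn.eq_of_hasGradientAt_zero (strictConvexOn_energy hinj hp g A) h1 hadm h2
      hcrit
  · rintro rfl
    exact ⟨hadm, hcrit⟩
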